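/- Consider a partially connected $K$-user interference network: receiver $\mathrm{R}_j$ hears its own transmitter $\mathrm{T}_j$ and the transmitters in a set $\mathcal{I}_j \subseteq [1:K]\setminus\{j\}$; the sets $\mathcal{I}_1,\dots,\mathcal{I}_K$ form the network topology. Each transmitter has one antenna; receiver $\mathrm{R}_j$ has a reconfigurable antenna with at least two preset modes, and $h_{j,i}(l)\in\mathbb{C}$ is the (time-invariant) gain from $\mathrm{T}_i$ to $\mathrm{R}_j$ in mode $l$. At each receiver the gain vectors $(h_{j,i}(l))_{i}$ of the different modes $l$ are independent random vectors with densities. A linear scheme over $m$ channel uses consists of beamforming matrices $\mathbf{V}_i\in\mathbb{C}^{m\times n_i}$ ($n_i$ is the number of symbols of $\mathrm{T}_i$) and preset mode patterns $(l_j(1),\dots,l_j(m))$, chosen from the topology alone and not from the gains. With $\mathbf{H}_{j,i}=\mathrm{diag}(h_{j,i}(l_j(1)),\dots,h_{j,i}(l_j(m)))$, the interference-free dimension at $\mathrm{R}_j$ is the dimension of the projection of $\mathrm{span}(\mathbf{H}_{j,j}\mathbf{V}_j)$ onto the orthogonal complement of $\sum_{i\in\mathcal{I}_j}\mathrm{span}(\mathbf{H}_{j,i}\mathbf{V}_i)$.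 The linear symmetric DoF $d$ is achievable if there are, for every $m$, a linear scheme over $m$ channel uses and integers $d_j(m)$ such that almost surely the interference-free dimension at every $\mathrm{R}_j$ is at least $d_j(m)$, and $\lim_{m\to\infty} d_j(m)/m=d$ for every $j$. The alignment graph is the undirected graph on $[1:K]$ in which $i\ne j$ are adjacent iff $\{i,j\}\subseteq\mathcal{I}_k$ for some $k$. An internal conflict from $i$ to $j$ means that $i\in\mathcal{I}_j$ and that $i$ and $j$ lie in the same connected component of the alignment graph; its conflict distance is the graph distance between $i$ and $j$ in the alignment graph. Let $\mathcal{B}$ be the set of vertices with at least two incoming internal conflicts, and let $\Delta_{\min}\in\{1,2,\dots\}\cup\{\infty\}$ be the minimum conflict distance among all internal conflicts towards vertices of $\mathcal{B}$ ($\Delta_{\min}=\infty$ if $\mathcal{B}=\emptyset$). The set of co-interferers of $\mathrm{T}_i$ is $\widehat{\mathcal{T}}_i=\bigcup_{j:\, i\in\mathcal{I}_j}\mathcal{I}_j\setminus\{i\}$, i.e. the set of neighbours of $i$ in the alignment graph. Theorem. If $|\widehat{\mathcal{T}}_i|\le 2$ for every $i\in[1:K]$, then the linear symmetric DoF $$\frac{\Delta_{\min}+1}{2\Delta_{\min}+3}$$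 (read as $\tfrac12$ if $\Delta_{\min}=\infty$) is achievable. Moreover, if $\Delta_{\min}<\infty$, there is a linear scheme over $2\Delta_{\min}+3$ channel uses in which every transmitter sends $\Delta_{\min}+1$ symbols and, almost surely, the interference-free dimension at every receiver is $\Delta_{\min}+1$. -/

import Mathlib

open MeasureTheory ProbabilityTheory Filter Topology

/-- The topology of a partially connected `K`-user interference network: `interferers j` is the set
`I_j` of transmitters, other than the intended transmitter `j`, that are heard by receiver `j`. The
direct link from transmitter `j` to receiver `j` is always present. -/
structure NetworkTopology (K : ℕ) where
  interferers : Fin K → Finset (Fin K)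
  not_mem_self : ∀ j, j ∉ interferers j

namespace NetworkTopology

variable {K : ℕ} (T : NetworkTopology K)

/-- The alignment graph: distinct vertices `i`, `j` are adjacent iff transmitters `i` and `j` both
interfere at some receiver `k`. -/
def alignmentGraph : SimpleGraph (Fin K) where
  Adj i j := i ≠ j ∧ ∃ k, i ∈ T.interferers k ∧ j ∈ T.interferers k
  symm := ⟨fun _ _ h => ⟨h.1.symm, h.2.imp fun _ hk => ⟨hk.2, hk.1⟩⟩⟩
  loopless := ⟨fun _ h => h.1 rfl⟩

/-- The (directed) conflict graph: there is an edge from `i` to `j` iff transmitter `i` interferes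
at receiver `j`. -/
def ConflictEdge (i j : Fin K) : Prop := i ∈ T.interferers j

/-- Two vertices belong to the same alignment set iff they are connected through alignment
edges. -/
def SameAlignmentSet (i j : Fin K) : Prop := T.alignmentGraph.Reachable i j

/-- An internal conflict from `i` to `j`: a conflict edge inside one alignment set. -/
def InternalConflict (i j : Fin K) : Prop := T.ConflictEdge i j ∧ T.SameAlignmentSet i j

/-- The number of alignment edges that have to be traversed to go from `i` to `j`. -/
noncomputable def conflictDistance (i j : Fin K) : ℕ∞ := T.alignmentGraph.edist i j

/-- The set `B` of vertices with two or more incoming internal conflicts. -/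
def multiConflictVertices : Set (Fin K) := {j | 2 ≤ {i | T.InternalConflict i j}.ncard}

/-- `Δ_min`: the minimum conflict distance among the internal conflicts towards vertices of `B`.
It is `⊤` exactly when `B` is empty. -/
noncomputable def minConflictDistance : ℕ∞ :=
  ⨅ (j : Fin K) (_ : j ∈ T.multiConflictVertices) (i : Fin K) (_ : T.InternalConflict i j),
    T.conflictDistance i j

/-- The co-interferers of transmitter `i`: the union of the sets `I_j \ {i}` over all receivers `j`
with `i ∈ I_j`. -/
def coInterferers (i : Fin K) : Finset (Fin K) :=
  (Finset.univ.filter fun j => i ∈ T.interferers j).biUnion fun j => T.interferers j \ {i}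

end NetworkTopology

/-- The value `(Δ + 1) / (2 Δ + 3)`, read as its limit `1 / 2` for `Δ = ∞`. -/
noncomputable def dofValue : ℕ∞ → ℝ
  | ⊤ => 1 / 2
  | (Δ : ℕ) => ((Δ : ℝ) + 1) / (2 * (Δ : ℝ) + 3)

/-- Channel gains when receiver `j` has `M j` preset modes: `h j l i` is the gain from transmitter
`i` to receiver `j` when receiver `j` is in mode `l`, so that `h j l` is the gain vector of mode `l`
to all the transmitters. -/
abbrev ChannelGains (K : ℕ) (M : Fin K → ℕ) : Type := (j : Fin K) → Fin (M j) → Fin K → ℂ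

/-- Admissible laws of the channel gains: at every receiver the gain vectors of the different preset
modes are independent, and each of them has a density with respect to Lebesgue measure. -/
structure IsChannelLaw {K : ℕ} {M : Fin K → ℕ} (μ : Measure (ChannelGains K M)) : Prop where
  isProbabilityMeasure : IsProbabilityMeasure μ
  indep : ∀ j, iIndepFun (fun (l : Fin (M j)) (h : ChannelGains K M) => h j l) μ
  absolutelyContinuous : ∀ j (l : Fin (M j)),
    μ.map (fun h : ChannelGains K M => h j l) ≪ (volume : Measure (Fin K → ℂ))

/-- A linear scheme over `m` channel uses: numbers of symbols, beamforming matrices, and preset mode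
patterns of the receivers. None of them refers to the channel gains. -/
structure LinearScheme (K : ℕ) (M : Fin K → ℕ) (m : ℕ) where
  numSymbols : Fin K → ℕ
  beam : (i : Fin K) → Matrix (Fin m) (Fin (numSymbols i)) ℂ
  mode : (j : Fin K) → Fin m → Fin (M j)

/-- The span of the columns of a matrix, as a subspace of the Hermitian space `ℂ^m`. -/
noncomputable def columnSpan {m n : ℕ} (A : Matrix (Fin m) (Fin n) ℂ) :
    Submodule ℂ (EuclideanSpace ℂ (Fin m)) :=
  Submodule.span ℂ (Set.range fun c : Fin n => WithLp.toLp 2 (fun t => A t c))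

namespace LinearScheme

variable {K m : ℕ} {M : Fin K → ℕ} (σ : LinearScheme K M m)

/-- The channel matrix from transmitter `i` to receiver `j` over the `m` channel uses. -/
def channelMatrix (h : ChannelGains K M) (j i : Fin K) : Matrix (Fin m) (Fin m) ℂ :=
  Matrix.diagonal fun t => h j (σ.mode j t) i

/-- The subspace in which receiver `j` receives the signal of transmitter `i`. -/
noncomputable def receivedSpace (h : ChannelGains K M) (j i : Fin K) :
    Submodule ℂ (EuclideanSpace ℂ (Fin m)) :=
  columnSpan (σ.channelMatrix h j i * σ.beam i)

/-- The interference signal subspace at receiver `j`. -/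
noncomputable def interferenceSpace (T : NetworkTopology K) (h : ChannelGains K M) (j : Fin K) :
    Submodule ℂ (EuclideanSpace ℂ (Fin m)) :=
  ⨆ i ∈ T.interferers j, σ.receivedSpace h j i

/-- The dimension of the projection of the desired signal subspace at receiver `j` onto the
orthogonal complement of the interference signal subspace. -/
noncomputable def desiredDim (T : NetworkTopology K) (h : ChannelGains K M) (j : Fin K) : ℕ :=
  Module.finrank ℂ ((σ.receivedSpace h j j).map
    ((σ.interferenceSpace T h j)ᗮ.starProjection : _ →ₗ[ℂ] EuclideanSpace ℂ (Fin m)))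

/-- The scheme secures `d j` interference-free dimensions at every receiver `j`, almost surely and
whatever the law of the channel gains. -/
def Secures (T : NetworkTopology K) (d : Fin K → ℕ) : Prop :=
  ∀ μ : Measure (ChannelGains K M), IsChannelLaw μ →
    ∀ᵐ h ∂μ, ∀ j, d j ≤ σ.desiredDim T h j

end LinearScheme

/-- Achievability of a linear DoF tuple `δ`: there are linear schemes over `m` channel uses, for all
`m`, chosen from the topology alone, that secure `d m j` interference-free dimensions at each
receiver `j`, with `d m j / m → δ j` as `m → ∞`. -/
def LDoFAchievable {K : ℕ} (T : NetworkTopology K) (M : Fin K → ℕ) (δ : Fin K → ℝ) : Prop :=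
  ∃ (σ : (m : ℕ) → LinearScheme K M m) (d : ℕ → Fin K → ℕ),
    (∀ m, (σ m).Secures T (d m)) ∧
      ∀ j, Tendsto (fun m : ℕ => (d m j : ℝ) / (m : ℝ)) atTop (𝓝 (δ j))

/-! Transmitters in one connected component of the alignment graph share a family of generic vectors
`v_x`. The graph has maximum degree at most two, so a component is a path or a cycle
(`SimpleGraph.exists_spanning_path`), and its vertices receive positions in `ZMod L`, a path being
embedded in a long cycle. In a component with a receiver that has multiple internal conflicts, the
transmitter at position `x` uses `v_x, …, v_{x + Δ}`; in the other components all the transmitters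
use the same `Δ + 1` vectors. The interference from one component at one receiver then lies in a
window of `Δ + 2` consecutive vectors, and `(Δ + 2) + (Δ + 1) = 2Δ + 3` leaves just enough room for
the desired signal, provided that no vector appears in both.

Two situations need the reconfigurable antenna. A single interferer may use the very vectors of the
desired signal; using different modes on two sets of channel uses separates them. Two
interferers at `x` and `x + 1` in the component of the receiver share the vectors
`v_{x + 1}, …, v_{x + Δ}`, none of which is desired because the conflict distances are at least `Δ`;
but `v_x` or `v_{x + Δ + 1}` may be desired. The supports are chosen to handle this: positions are
coloured by the channel uses so that any `Δ + 2` consecutive colours differ (`exists_isSpread`), and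
`v_x` vanishes exactly at the colours of `x - Δ, …, x`. Using the second mode only at the colours of
`x` and `x + 1` keeps the shared vectors aligned, as they vanish there, and makes the desired copies
of `v_x` and `v_{x + Δ + 1}` independent of the interfering ones
(`nonempty_certificate_of_internal`).

Linear independence of the interference and the desired columns is a generic property, so it
suffices to exhibit, for each receiver separately, one choice of vectors and gains for which it
holds. That choice comes from a matching of the columns to channel uses in their supports, found by
Hall's theorem; the Hall condition is `IsSpread.card_biUnion_slotSupport`. Since nonzero polynomials
vanish on null sets only, one choice of the vectors works for almost all gains at all receivers
(`exists_linearScheme_of_certificates`).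

For the degrees of freedom, the scheme over `2Δ + 3` channel uses is repeated when `Δ` is finite;
when no receiver has multiple internal conflicts, `Δ` may be taken to grow with the number of
channel uses. -/

/-! ### Zero sets of polynomials in the gains -/

theorem MvPolynomial.ae_eval_ne_zero_fin {n : ℕ} (p : MvPolynomial (Fin n) ℂ) (hp : p ≠ 0) :
    ∀ᵐ x ∂(volume : Measure (Fin n → ℂ)), MvPolynomial.eval x p ≠ 0 := by
  induction n with
  | zero =>
    refine Filter.Eventually.of_forall fun x hx => hp ?_
    rw [MvPolynomial.eq_C_of_isEmpty p] at hx ⊢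
    rw [MvPolynomial.eval_C] at hx
    rw [hx, map_zero]
  | succ n ih =>
    set q := MvPolynomial.finSuccEquiv ℂ n p with hq
    have hq0 : q ≠ 0 := by simpa [hq] using hp
    have hc : q.leadingCoeff ≠ 0 := Polynomial.leadingCoeff_ne_zero.mpr hq0
    have hcont : Continuous fun z : ℂ × (Fin n → ℂ) =>
        MvPolynomial.eval (Fin.cons z.1 z.2 : Fin (n + 1) → ℂ) p :=
      (MvPolynomial.continuous_eval p).comp (by fun_prop)
    have hmeas : MeasurableSet {z : ℂ × (Fin n → ℂ) |
        MvPolynomial.eval (Fin.cons z.1 z.2 : Fin (n + 1) → ℂ) p ≠ 0} :=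
      (isOpen_ne_fun hcont continuous_const).measurableSet
    have hprod : ∀ᵐ z ∂((volume : Measure ℂ).prod (volume : Measure (Fin n → ℂ))),
        MvPolynomial.eval (Fin.cons z.1 z.2 : Fin (n + 1) → ℂ) p ≠ 0 := by
      rw [Measure.ae_prod_iff_ae_ae hmeas, Measure.ae_ae_comm hmeas]
      filter_upwards [ih _ hc] with s hs
      have hr : q.map (MvPolynomial.eval s) ≠ 0 := fun h => hs <| by
        simpa using congrArg (fun r : Polynomial ℂ => r.coeff q.natDegree) h
      have hfin : {y : ℂ | (q.map (MvPolynomial.eval s)).IsRoot y}.Finite :=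
        Polynomial.finite_setOfPred_isRoot hr
      filter_upwards [hfin.countable.ae_notMem volume] with y hy h0
      exact hy (by simpa [hq, MvPolynomial.eval_eq_eval_mv_eval'] using h0)
    have hmp := volume_preserving_piFinSuccAbove (fun _ : Fin (n + 1) => ℂ) 0
    have := hmp.quasiMeasurePreserving.ae hprod
    filter_upwards [this] with x hx
    convert hx using 2
    congr 1
    funext i
    refine Fin.cases ?_ (fun i => ?_) i <;> simp [MeasurableEquiv.piFinSuccAbove, Fin.tail]

/-- A nonzero complex polynomial in finitely many variables vanishes only on a Lebesgue null set. -/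
theorem MvPolynomial.ae_eval_ne_zero {ι : Type*} [Fintype ι] (p : MvPolynomial ι ℂ) (hp : p ≠ 0) :
    ∀ᵐ x ∂(volume : Measure (ι → ℂ)), MvPolynomial.eval x p ≠ 0 := by
  let e := Fintype.equivFin ι
  have h := MvPolynomial.ae_eval_ne_zero_fin (MvPolynomial.rename e p)
    (fun h => hp (MvPolynomial.rename_injective e e.injective (by simpa using h)))
  have hmp := volume_measurePreserving_piCongrLeft (fun _ : Fin (Fintype.card ι) => ℂ) e
  filter_upwards [hmp.quasiMeasurePreserving.ae h] with x hx
  rw [MvPolynomial.eval_rename] at hx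
  convert hx using 2
  congr 1
  funext i
  simp [MeasurableEquiv.piCongrLeft, Equiv.piCongrLeft_apply]

/-- Under an admissible channel law, a nonzero polynomial in the gains of two different modes of one
receiver almost surely does not vanish. -/
theorem IsChannelLaw.ae_eval_ne_zero {K : ℕ} {M : Fin K → ℕ} {μ : Measure (ChannelGains K M)}
    (hμ : IsChannelLaw μ) (j : Fin K) {l₀ l₁ : Fin (M j)} (hl : l₀ ≠ l₁)
    (p : MvPolynomial (Fin K ⊕ Fin K) ℂ) (hp : p ≠ 0) :
    ∀ᵐ h ∂μ, MvPolynomial.eval (Sum.elim (h j l₀) (h j l₁)) p ≠ 0 := by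
  have := hμ.isProbabilityMeasure
  have hm : ∀ l : Fin (M j), Measurable fun h : ChannelGains K M => h j l := fun l => by fun_prop
  have hind := (hμ.indep j).indepFun hl
  rw [indepFun_iff_map_prod_eq_prod_map_map (hm _).aemeasurable (hm _).aemeasurable] at hind
  have hac := (hμ.absolutelyContinuous j l₀).prod (hμ.absolutelyContinuous j l₁)
  rw [← hind] at hac
  have hmp := volume_measurePreserving_sumPiEquivProdPi_symm (fun _ : Fin K ⊕ Fin K => ℂ)
  have h1 := hmp.quasiMeasurePreserving.ae (MvPolynomial.ae_eval_ne_zero p hp)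
  have h2 := ae_of_ae_map (by fun_prop) (hac.ae_le h1)
  filter_upwards [h2] with h hh
  convert hh using 2
  congr 1

/-! ### Lower bounds for the interference-free dimension -/

namespace LinearScheme

variable {K m : ℕ} {M : Fin K → ℕ} (σ : LinearScheme K M m)

/-- Any linear map that kills the interference bounds the number of interference-free dimensions
from below by the dimension of the image of the desired signal. -/
theorem finrank_map_le_desiredDim (T : NetworkTopology K) (h : ChannelGains K M) (j : Fin K)
    {F : Type*} [AddCommGroup F] [Module ℂ F] (φ : EuclideanSpace ℂ (Fin m) →ₗ[ℂ] F)
    (hφ : σ.interferenceSpace T h j ≤ LinearMap.ker φ) :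
    Module.finrank ℂ ((σ.receivedSpace h j j).map φ) ≤ σ.desiredDim T h j := by
  have hcomp : φ ∘ₗ ((σ.interferenceSpace T h j)ᗮ.starProjection : _ →ₗ[ℂ] _) = φ := by
    ext1 x
    have hx := hφ ((σ.interferenceSpace T h j).orthogonal_orthogonal ▸
      (σ.interferenceSpace T h j)ᗮ.sub_starProjection_mem_orthogonal x)
    rw [LinearMap.mem_ker, map_sub, sub_eq_zero] at hx
    exact hx.symm
  rw [desiredDim]
  conv_lhs => rw [← hcomp, Submodule.map_comp]
  exact Submodule.finrank_map_le _ _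

theorem le_desiredDim_of_linearIndependent (T : NetworkTopology K) (h : ChannelGains K M)
    (j : Fin K) {κ : Type*} {n : ℕ} {x : κ → EuclideanSpace ℂ (Fin m)}
    {y : Fin n → EuclideanSpace ℂ (Fin m)} (hxy : LinearIndependent ℂ (Sum.elim x y))
    (hx : σ.interferenceSpace T h j ≤ Submodule.span ℂ (Set.range x))
    (hy : ∀ d, y d ∈ σ.receivedSpace h j j) :
    n ≤ σ.desiredDim T h j := by
  refine le_trans ?_ (σ.finrank_map_le_desiredDim T h j (Submodule.span ℂ (Set.range x)).mkQ
    (by rwa [Submodule.ker_mkQ]))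
  obtain ⟨-, hiy, hd⟩ := linearIndependent_sum.mp hxy
  have hli : LinearIndependent ℂ ((Submodule.span ℂ (Set.range x)).mkQ ∘ y) :=
    LinearIndependent.map hiy (by rw [Submodule.ker_mkQ]; exact hd.symm)
  have hcard := finrank_span_eq_card hli
  rw [Fintype.card_fin] at hcard
  rw [← hcard]
  refine Submodule.finrank_mono (Submodule.span_le.mpr ?_)
  rintro _ ⟨d, rfl⟩
  exact Submodule.mem_map_of_mem (hy d)

end LinearScheme

/-! ### Schemes from matchings of columns to channel uses -/

/-- Extension of the gains of one receiver by the trivial channel `none`, of gain `1`. -/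
def extendedGain {R : Type*} [One R] {K : ℕ} (g : Bool → Fin K → R) : Option (Fin K) → Bool → R
  | none, _ => 1
  | some i, b => g b i

/-- A certificate that the receiver `j` can separate its signal from the interference when
transmitter `i` sends its symbols along the vectors `w i d` and these vectors are generic among the
vectors with the supports `supp`. The interference is spanned by columns indexed by `κ`: the column
`c` is the vector `vec (inl c)` transmitted through the channel `tx c`, where `none` stands for the
channel of gain one. The desired columns are indexed by `Fin n`. The matching `f` of the columns to
channel uses and the gains `gain` specify a point at which the columns restricted to the rows in the
range of `f` form the identity matrix. -/
structure SeparationCertificate {K m n : ℕ} (T : NetworkTopology K) {Ω : Type}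
    (w : Fin K → Fin n → Ω) (supp : Ω → Finset (Fin m)) (j : Fin K) where
  /-- index set of the interference columns -/
  κ : Type
  [fintype : Fintype κ]
  [decEq : DecidableEq κ]
  vec : κ → Ω
  tx : κ → Option (Fin K)
  f : κ ⊕ Fin n → Fin m
  f_injective : Function.Injective f
  f_mem : ∀ c, f c ∈ supp (Sum.elim vec (w j) c)
  /-- mode pattern of the receiver, `true` being the second mode -/
  mode : Fin m → Bool
  gain : Bool → Fin K → ℂ
  gain_eq_one : ∀ c, extendedGain gain (Sum.elim tx (fun _ => some j) c) (mode (f c)) = 1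
  gain_eq_zero : ∀ c c', c' ≠ c → Sum.elim vec (w j) c' = Sum.elim vec (w j) c →
    extendedGain gain (Sum.elim tx (fun _ => some j) c) (mode (f c')) = 0
  covers : ∀ i ∈ T.interferers j, ∀ d, ∃ c, vec c = w i d ∧
    (tx c = some i ∨ (tx c = none ∧ ∃ b, ∀ s ∈ supp (w i d), mode s = b))

namespace SeparationCertificate

attribute [instance] fintype decEq

variable {K m n : ℕ} {T : NetworkTopology K} {Ω : Type} {w : Fin K → Fin n → Ω}
  {supp : Ω → Finset (Fin m)} {j : Fin K} (P : SeparationCertificate T w supp j)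

/-- The matrix of the columns of a certificate, restricted to the rows selected by the matching, for
vectors `v` and gains `g` with entries in an arbitrary commutative ring. -/
def minor {R : Type*} [CommRing R] (v : Ω → Fin m → R) (g : Bool → Fin K → R) :
    Matrix (P.κ ⊕ Fin n) (P.κ ⊕ Fin n) R :=
  Matrix.of fun c' c =>
    (if P.f c' ∈ supp (Sum.elim P.vec (w j) c) then v (Sum.elim P.vec (w j) c) (P.f c') else 0) *
      extendedGain g (Sum.elim P.tx (fun _ => some j) c) (P.mode (P.f c'))

theorem map_minor {R S : Type*} [CommRing R] [CommRing S] (φ : R →+* S) (v : Ω → Fin m → R)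
    (g : Bool → Fin K → R) :
    φ (P.minor v g).det = (P.minor (fun ω s => φ (v ω s)) fun b i => φ (g b i)).det := by
  rw [RingHom.map_det]
  congr 1
  ext c' c
  simp only [minor, RingHom.mapMatrix_apply, Matrix.map_apply, Matrix.of_apply, map_mul]
  congr 1
  · split_ifs <;> simp
  · cases (Sum.elim P.tx (fun _ => some j) c) <;> simp [extendedGain]

theorem exists_det_minor_ne_zero : ∃ v : Ω → Fin m → ℂ, (P.minor v P.gain).det ≠ 0 := by
  classical
  refine ⟨fun ω s => if ∃ c, Sum.elim P.vec (w j) c = ω ∧ P.f c = s then 1 else 0, ?_⟩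
  suffices h : P.minor (fun ω s => if ∃ c, Sum.elim P.vec (w j) c = ω ∧ P.f c = s then (1 : ℂ)
      else 0) P.gain = 1 by rw [h, Matrix.det_one]; exact one_ne_zero
  ext c' c
  rw [minor, Matrix.of_apply]
  by_cases hc : c' = c
  · subst hc
    rw [if_pos (P.f_mem _), if_pos ⟨c', rfl, rfl⟩, P.gain_eq_one, Matrix.one_apply_eq, one_mul]
  · rw [Matrix.one_apply_ne hc]
    by_cases hv : Sum.elim P.vec (w j) c' = Sum.elim P.vec (w j) c
    · rw [P.gain_eq_zero c c' hc hv, mul_zero]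
    · rw [if_neg (c := ∃ c₁, _), ite_self, zero_mul]
      rintro ⟨c₁, h₁, h₂⟩
      rw [P.f_injective h₂] at h₁
      exact hv h₁

end SeparationCertificate

/-- If every receiver has a separation certificate, then generic vectors with the prescribed
supports give a linear scheme that secures all the symbols of all the transmitters. -/
theorem exists_linearScheme_of_certificates {K m n : ℕ} (T : NetworkTopology K) (M : Fin K → ℕ)
    (hM : ∀ j, 2 ≤ M j) {Ω : Type} (w : Fin K → Fin n → Ω) (supp : Ω → Finset (Fin m))
    (P : ∀ j, SeparationCertificate T w supp j) :
    ∃ σ : LinearScheme K M m, (∀ i, σ.numSymbols i = n) ∧ σ.Secures T (fun _ => n) := by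
  classical
  -- a common choice of the vectors: the product of the minors of all the receivers is a nonzero
  -- polynomial when every receiver has its own gain variables
  obtain ⟨v, hv⟩ : ∃ v : Ω → Fin m → ℂ, ∀ j, ∃ g, ((P j).minor v g).det ≠ 0 := by
    let D : Fin K → MvPolynomial ((Ω × Fin m) ⊕ (Fin K × Bool × Fin K)) ℂ := fun j =>
      ((P j).minor (fun ω s => MvPolynomial.X (Sum.inl (ω, s)))
        fun b i => MvPolynomial.X (Sum.inr (j, b, i))).det
    have hD : ∀ j x, MvPolynomial.eval x (D j) = ((P j).minor (fun ω s => x (Sum.inl (ω, s)))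
        fun b i => x (Sum.inr (j, b, i))).det := fun j x => by
      rw [(P j).map_minor]; simp
    have hD0 : ∏ j, D j ≠ 0 := by
      refine Finset.prod_ne_zero_iff.mpr fun j _ hj => ?_
      obtain ⟨v, hv⟩ := (P j).exists_det_minor_ne_zero
      have := hD j (Sum.elim (fun q => v q.1 q.2) fun q => (P j).gain q.2.1 q.2.2)
      rw [hj, map_zero] at this
      exact hv this.symm
    obtain ⟨x, hx⟩ : ∃ x, MvPolynomial.eval x (∏ j, D j) ≠ 0 := by
      by_contra! hcon
      exact hD0 (MvPolynomial.funext fun x => by rw [hcon, map_zero])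
    rw [map_prod, Finset.prod_ne_zero_iff] at hx
    exact ⟨fun ω s => x (Sum.inl (ω, s)), fun j => ⟨_, hD j x ▸ hx j (Finset.mem_univ j)⟩⟩
  let V : Ω → Fin m → ℂ := fun ω s => if s ∈ supp ω then v ω s else 0
  let l : (j : Fin K) → Bool → Fin (M j) := fun j b =>
    if b then ⟨1, hM j⟩ else ⟨0, lt_of_lt_of_le two_pos (hM j)⟩
  have hl : ∀ j, l j false ≠ l j true := fun j => by simp [l]
  let σ : LinearScheme K M m :=
    { numSymbols := fun _ => n
      beam := fun i => Matrix.of fun s d => V (w i d) s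
      mode := fun j s => l j ((P j).mode s) }
  refine ⟨σ, fun _ => rfl, fun μ hμ => ae_all_iff.mpr fun j => ?_⟩
  obtain ⟨g, hg⟩ := hv j
  let p : MvPolynomial (Fin K ⊕ Fin K) ℂ := ((P j).minor (fun ω s => MvPolynomial.C (v ω s))
    fun b i => MvPolynomial.X (if b then Sum.inr i else Sum.inl i)).det
  have hp : ∀ x, MvPolynomial.eval x p =
      ((P j).minor v fun b i => x (if b then Sum.inr i else Sum.inl i)).det := fun x => by
    rw [(P j).map_minor]; simp
  have hp0 : p ≠ 0 := fun h0 => hg <| by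
    have := hp (Sum.elim (g false) (g true))
    rw [h0, map_zero] at this
    rw [this]
    congr 2
    funext b i
    cases b <;> rfl
  filter_upwards [hμ.ae_eval_ne_zero j (hl j) p hp0] with h hh
  rw [hp] at hh
  -- the received columns
  let G : Option (Fin K) → Bool → ℂ := extendedGain fun b i => h j (l j b) i
  let col : (P j).κ ⊕ Fin n → EuclideanSpace ℂ (Fin m) := fun c =>
    WithLp.toLp 2 fun s => V (Sum.elim (P j).vec (w j) c) s *
      G (Sum.elim (P j).tx (fun _ => some j) c) ((P j).mode s)
  have hcolumn : ∀ i d, (WithLp.toLp 2 fun s => (σ.channelMatrix h j i * σ.beam i) s d) =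
      WithLp.toLp 2 fun s => V (w i d) s * G (some i) ((P j).mode s) := fun i d => by
    ext s
    simp [LinearScheme.channelMatrix, σ, G, extendedGain, mul_comm]
  have hreceived : ∀ i d, (WithLp.toLp 2 fun s => V (w i d) s * G (some i) ((P j).mode s)) ∈
      σ.receivedSpace h j i := fun i d => Submodule.subset_span ⟨d, hcolumn i d⟩
  have hspan : ∀ (i : Fin K) (U : Submodule ℂ (EuclideanSpace ℂ (Fin m))),
      (∀ d, (WithLp.toLp 2 fun s => V (w i d) s * G (some i) ((P j).mode s)) ∈ U) →
      σ.receivedSpace h j i ≤ U := fun i U hU => by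
    refine Submodule.span_le.mpr ?_
    rintro _ ⟨d, rfl⟩
    have := hU d
    rw [← hcolumn i d] at this
    exact this
  have hli : LinearIndependent ℂ col := by
    have hrow : LinearIndependent ℂ
        ((P j).minor v fun b i => h j (l j b) i).col :=
      Matrix.linearIndependent_cols_of_det_ne_zero (by
        convert hh using 4 with b i
        cases b <;> rfl)
    let ρ : EuclideanSpace ℂ (Fin m) →ₗ[ℂ] ((P j).κ ⊕ Fin n → ℂ) :=
      LinearMap.pi fun c => (EuclideanSpace.proj ((P j).f c) : _ →L[ℂ] ℂ).toLinearMap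
    refine LinearIndependent.of_comp ρ ?_
    convert hrow using 1
    funext c c'
    rfl
  refine σ.le_desiredDim_of_linearIndependent T h j (x := col ∘ Sum.inl) (y := col ∘ Sum.inr)
    (by rwa [Sum.elim_comp_inl_inr]) ?_ (hreceived j)
  refine iSup₂_le fun i hi => hspan i _ fun d => ?_
  obtain ⟨c, hc, h1 | ⟨h1, b, hb⟩⟩ := (P j).covers i hi d
  · refine Submodule.subset_span ⟨c, ?_⟩
    simp [col, hc, h1]
  · -- the mode is constant on the support, so the channel acts as a scalar
    have : (WithLp.toLp 2 fun s => V (w i d) s * G (some i) ((P j).mode s)) =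
        G (some i) b • col (Sum.inl c) := by
      ext s
      by_cases hs : s ∈ supp (w i d)
      · simp [col, hc, h1, hb s hs, G, extendedGain, mul_comm]
      · simp [col, hc, V, hs]
    rw [this]
    exact Submodule.smul_mem _ _ (Submodule.subset_span ⟨c, rfl⟩)

/-! ### Matchings and supports -/

/-- Hall's theorem for two families: in a set of columns from both, the first family alone already
occupies enough rows. -/
theorem exists_matching_sum {α κ : Type*} [DecidableEq α] [Fintype κ] {n : ℕ} (S₁ : κ → Finset α)
    (S₂ : Fin n → Finset α) (h₁ : ∀ A : Finset κ, A.Nonempty → n + A.card ≤ (A.biUnion S₁).card)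
    (h₂ : ∀ A : Finset (Fin n), A.Nonempty → A.card ≤ (A.biUnion S₂).card) :
    ∃ f : κ ⊕ Fin n → α, Function.Injective f ∧ ∀ c, f c ∈ Sum.elim S₁ S₂ c := by
  classical
  refine (Finset.all_card_le_biUnion_card_iff_exists_injective _).mp fun A => ?_
  rw [← Finset.card_toLeft_add_card_toRight]
  have hl : A.toLeft.biUnion S₁ ⊆ A.biUnion (Sum.elim S₁ S₂) := fun s hs => by
    obtain ⟨c, hc, hs⟩ := Finset.mem_biUnion.mp hs
    exact Finset.mem_biUnion.mpr ⟨Sum.inl c, Finset.mem_toLeft.mp hc, hs⟩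
  have hr : A.toRight.biUnion S₂ ⊆ A.biUnion (Sum.elim S₁ S₂) := fun s hs => by
    obtain ⟨c, hc, hs⟩ := Finset.mem_biUnion.mp hs
    exact Finset.mem_biUnion.mpr ⟨Sum.inr c, Finset.mem_toRight.mp hc, hs⟩
  have hn : A.toRight.card ≤ n := by simpa using Finset.card_le_univ A.toRight
  rcases A.toLeft.eq_empty_or_nonempty with h | h
  · rcases A.toRight.eq_empty_or_nonempty with h' | h'
    · simp [h, h']
    · have := h₂ _ h'
      have := Finset.card_le_card hr
      simp only [h, Finset.card_empty]
      omega
  · have := h₁ _ h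
    have := Finset.card_le_card hl
    omega

section Slots

variable {R : Type*} [CommRing R] {Δ : ℕ}

/-- A colouring of the positions by the `2Δ + 3` channel uses such that any `Δ + 2` consecutive
positions have different colours. -/
def IsSpread (t : R → Fin (2 * Δ + 3)) : Prop :=
  ∀ (x : R) (s : ℕ), 1 ≤ s → s ≤ Δ + 1 → t (x + s) ≠ t x

/-- The support of the vector at position `x`: it vanishes at the channel uses which are the colours
of `x - Δ, …, x`. -/
def slotSupport (t : R → Fin (2 * Δ + 3)) (x : R) : Finset (Fin (2 * Δ + 3)) :=
  Finset.univ \ (Finset.range (Δ + 1)).image fun e : ℕ => t (x - e)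

theorem mem_slotSupport {t : R → Fin (2 * Δ + 3)} {x : R} {s : Fin (2 * Δ + 3)} :
    s ∈ slotSupport t x ↔ ∀ e : ℕ, e ≤ Δ → t (x - e) ≠ s := by
  simp [slotSupport]

namespace IsSpread

variable {t : R → Fin (2 * Δ + 3)}

/-- Vectors at positions in a window of length `Δ + 2` jointly use many channel uses. If all the
vectors in `A` vanish at the colour of the position `x`, then neither `x - 1` nor `x + Δ + 1` is in
`A`, and exactly one of the two lies in the window. -/
theorem card_biUnion_slotSupport (ht : IsSpread t) (a : R) {A : Finset ℕ} (hA : A ⊆ Finset.range (Δ + 2))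
    (hne : A.Nonempty) :
    Δ + 1 + A.card ≤ (A.biUnion fun d => slotSupport t (a + d)).card := by
  obtain ⟨p, hp⟩ := hne
  set U := A.biUnion fun d => slotSupport t (a + d) with hU
  have hpΔ : p < Δ + 2 := Finset.mem_range.mp (hA hp)
  let E : Finset ℕ := (Finset.range (Δ + 1)).filter fun e => t (a + p - e) ∈ Uᶜ
  have h1 : Uᶜ.card ≤ E.card := by
    refine (Finset.card_le_card (t := E.image fun e : ℕ => t (a + p - e)) fun s hs => ?_).trans
      Finset.card_image_le
    have : s ∉ slotSupport t (a + p) := fun h =>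
      Finset.mem_compl.mp hs (Finset.mem_biUnion.mpr ⟨p, hp, h⟩)
    rw [mem_slotSupport] at this
    push Not at this
    obtain ⟨e, he, rfl⟩ := this
    exact Finset.mem_image.mpr ⟨e, Finset.mem_filter.mpr ⟨Finset.mem_range.mpr (by omega), hs⟩, rfl⟩
  have h2 : E.card ≤ (Finset.range (Δ + 2) \ A).card := by
    refine Finset.card_le_card_of_injOn (fun e => if e + 1 ≤ p then p - e - 1 else p + Δ + 1 - e)
      (fun e he => ?_) (fun e he e' he' h => ?_)
    · obtain ⟨he, heU⟩ := Finset.mem_filter.mp he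
      rw [Finset.mem_range] at he
      have key : ∀ d : ℕ, (d + e = p + Δ + 1 ∨ d + 1 + e = p) → d ∉ A := by
        intro d hd hdA
        obtain ⟨e', he', h⟩ : ∃ e' : ℕ, e' ≤ Δ ∧ t (a + d - e') = t (a + p - e) := by
          by_contra! hcon
          exact Finset.mem_compl.mp heU
            (Finset.mem_biUnion.mpr ⟨d, hdA, mem_slotSupport.mpr hcon⟩)
        rcases hd with hd | hd
        · have hk : ((d + e : ℕ) : R) = ((p + (Δ + 1 - e') + e' : ℕ) : R) := by congr 1; omega
          refine ht (a + p - e) (Δ + 1 - e') (by omega) (by omega) (Eq.trans ?_ h)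
          congr 1
          push_cast at hk
          linear_combination -hk
        · refine ht (a + d - e') (e' + 1) (by omega) (by omega) (Eq.trans ?_ h.symm)
          congr 1
          rw [← hd]
          push_cast
          ring
      simp only [Finset.coe_sdiff, Finset.coe_range, Set.mem_sdiff, Set.mem_Iio, Finset.mem_coe]
      split_ifs with hep
      · exact ⟨by omega, key _ (Or.inr (by omega))⟩
      · exact ⟨by omega, key _ (Or.inl (by omega))⟩
    · have := (Finset.mem_filter.mp he).1
      have := (Finset.mem_filter.mp he').1
      simp only [Finset.mem_range] at *
      split_ifs at h <;> omega
  have h3 := Finset.card_sdiff_add_card_eq_card hA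
  have h4 := Finset.card_compl U
  rw [Fintype.card_fin] at h4
  have h5 : U.card ≤ 2 * Δ + 3 := by simpa using Finset.card_le_univ U
  rw [Finset.card_range] at h3
  omega

/-- A version of `card_biUnion_slotSupport` for windows of length at most `Δ + 2` indexed by
`Fin`. -/
theorem card_biUnion_slotSupport_fin (ht : IsSpread t) (a : R) {r : ℕ} (hr : r ≤ Δ + 2)
    {A : Finset (Fin r)} (hne : A.Nonempty) :
    Δ + 1 + A.card ≤ (A.biUnion fun d => slotSupport t (a + (d : ℕ))).card := by
  have := ht.card_biUnion_slotSupport a (A := A.map Fin.valEmbedding) (fun d hd => by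
    obtain ⟨d, -, rfl⟩ := Finset.mem_map.mp hd
    exact Finset.mem_range.mpr (d.2.trans_le hr)) (hne.map)
  rw [Finset.card_map] at this
  refine this.trans_eq (congrArg _ ?_)
  ext s
  simp

theorem add_natCast_injective (ht : IsSpread t) (a : R) {d d' : ℕ} (hd : d ≤ Δ + 1)
    (hd' : d' ≤ Δ + 1) (h : a + (d : R) = a + d') : d = d' := by
  wlog hlt : d ≤ d' generalizing d d'
  · exact (this hd' hd h.symm (by omega)).symm
  by_contra hne
  refine ht (a + d) (d' - d) (by omega) (by omega) ?_
  congr 1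
  rw [Nat.cast_sub hlt]
  linear_combination -h

/-- The colour of `x` is not used at the `Δ + 1` positions `x, …, x + Δ`. -/
theorem notMem_slotSupport_add (x : R) {d : ℕ} (hd : d ≤ Δ) : t x ∉ slotSupport t (x + d) :=
  fun h => mem_slotSupport.mp h d hd (by rw [add_sub_cancel_right])

theorem mem_slotSupport_add_succ (ht : IsSpread t) (x : R) :
    t x ∈ slotSupport t (x + (Δ + 1 : ℕ)) :=
  mem_slotSupport.mpr fun e he h => by
    refine ht x (Δ + 1 - e) (by omega) (by omega) ?_
    rw [Nat.cast_sub (by omega), ← add_sub_assoc]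
    exact h

theorem mem_slotSupport_sub_one (ht : IsSpread t) (x : R) : t (x + 1) ∈ slotSupport t x :=
  mem_slotSupport.mpr fun e he h => by
    refine ht (x - e) (e + 1) (by omega) (by omega) (Eq.trans ?_ h.symm)
    congr 1
    push_cast
    ring

theorem apply_add_one_ne (ht : IsSpread t) (x : R) : t (x + 1) ≠ t x := by
  simpa using ht x 1 le_rfl (by omega)

end IsSpread

/-- Spread colourings of the integers modulo `L` exist when the window does not wrap around: colour
greedily, every position having at most `2Δ + 2` positions too close to it. -/
theorem exists_isSpread {Δ L : ℕ} (hL : Δ + 2 ≤ L) :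
    ∃ t : ZMod L → Fin (2 * Δ + 3), IsSpread t := by
  classical
  have : NeZero L := ⟨by omega⟩
  suffices h : ∀ S : Finset (ZMod L), ∃ t : ZMod L → Fin (2 * Δ + 3), ∀ x ∈ S, ∀ s : ℕ, 1 ≤ s →
      s ≤ Δ + 1 → x + s ∈ S → t (x + s) ≠ t x by
    obtain ⟨t, ht⟩ := h Finset.univ
    exact ⟨t, fun x s h1 h2 => ht x (Finset.mem_univ _) s h1 h2 (Finset.mem_univ _)⟩
  intro S
  induction S using Finset.induction_on with
  | empty => exact ⟨fun _ => 0, by simp⟩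
  | insert y S hy ih =>
    obtain ⟨t, ht⟩ := ih
    let N : Finset (Fin (2 * Δ + 3)) :=
      (Finset.Icc 1 (Δ + 1)).image (fun s : ℕ => t (y + s)) ∪
        (Finset.Icc 1 (Δ + 1)).image fun s : ℕ => t (y - s)
    obtain ⟨b, hb⟩ : ∃ b, b ∉ N := by
      by_contra! hcon
      have h1 : N = Finset.univ := Finset.eq_univ_iff_forall.mpr hcon
      have h2 : N.card ≤ (Δ + 1) + (Δ + 1) := (Finset.card_union_le _ _).trans
        (Nat.add_le_add (Finset.card_image_le.trans (by simp)) (Finset.card_image_le.trans (by simp)))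
      rw [h1, Finset.card_univ, Fintype.card_fin] at h2
      omega
    have hb1 : ∀ s : ℕ, 1 ≤ s → s ≤ Δ + 1 → t (y + s) ≠ b := fun s h1 h2 h => hb <|
      Finset.mem_union_left _ (Finset.mem_image.mpr ⟨s, Finset.mem_Icc.mpr ⟨h1, h2⟩, h⟩)
    have hb2 : ∀ s : ℕ, 1 ≤ s → s ≤ Δ + 1 → t (y - s) ≠ b := fun s h1 h2 h => hb <|
      Finset.mem_union_right _ (Finset.mem_image.mpr ⟨s, Finset.mem_Icc.mpr ⟨h1, h2⟩, h⟩)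
    refine ⟨Function.update t y b, fun x hx s h1 h2 hxs => ?_⟩
    have hne : x + (s : ZMod L) ≠ x := by
      intro h
      rw [add_eq_left, ZMod.natCast_eq_zero_iff] at h
      have := Nat.le_of_dvd h1 h
      omega
    by_cases hxy : x = y
    · subst hxy
      rw [Function.update_of_ne hne, Function.update_self]
      exact hb1 s h1 h2
    · rw [Function.update_of_ne hxy]
      by_cases hxsy : x + s = y
      · rw [hxsy, Function.update_self]
        have := hb2 s h1 h2
        rw [← hxsy, add_sub_cancel_right] at this
        exact this.symm
      · rw [Function.update_of_ne hxsy]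
        exact ht x (Finset.mem_of_mem_insert_of_ne hx hxy) s h1 h2
          (Finset.mem_of_mem_insert_of_ne hxs hxsy)

end Slots

/-! ### Certificates for the receivers -/

section Windows

variable {K Δ : ℕ} {ι : Type} (L : ι → ℕ) (t : (c : ι) → ZMod (L c) → Fin (2 * Δ + 3))
  (comp : Fin K → ι) (pos : (c : ι) → Fin K → ZMod (L c))

/-- Transmitter `i`, at a position of the line or cycle `comp i`, uses the vectors at `Δ + 1`
consecutive positions from its own one on. -/
def windowVec (i : Fin K) (d : Fin (Δ + 1)) : Σ c, ZMod (L c) :=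
  ⟨comp i, pos (comp i) i + (d : ℕ)⟩

/-- The supports of the vectors at all the positions of all the lines and cycles. -/
def sigmaSupport (ω : Σ c, ZMod (L c)) : Finset (Fin (2 * Δ + 3)) := slotSupport (t ω.1) ω.2

variable {L t comp pos} (T : NetworkTopology K)

theorem windowVec_injective (ht : ∀ c, IsSpread (t c)) (i : Fin K) :
    Function.Injective (windowVec (Δ := Δ) L comp pos i) := fun d d' h => by
  rw [windowVec, windowVec, Sigma.mk.injEq, heq_eq_eq] at h
  exact Fin.ext ((ht _).add_natCast_injective _ (by omega) (by omega) h.2)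

theorem card_biUnion_windowVec (ht : ∀ c, IsSpread (t c)) (i : Fin K)
    {A : Finset (Fin (Δ + 1))} (hA : A.Nonempty) :
    Δ + 1 + A.card ≤ (A.biUnion fun d => sigmaSupport L t (windowVec L comp pos i d)).card :=
  (ht (comp i)).card_biUnion_slotSupport_fin _ (by omega) hA

/-- A receiver in a constant mode: the interference lies in the span of known vectors, different
from the desired ones, that can be matched together with them. -/
theorem nonempty_certificate_of_const {κ : Type} [Fintype κ] [DecidableEq κ] {j : Fin K}
    (ht : ∀ c, IsSpread (t c)) (vec : κ → Σ c, ZMod (L c)) (hvec : Function.Injective vec)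
    (hne : ∀ k (d : Fin (Δ + 1)), vec k ≠ windowVec L comp pos j d)
    (hcard : ∀ A : Finset κ, A.Nonempty →
      Δ + 1 + A.card ≤ (A.biUnion fun k => sigmaSupport L t (vec k)).card)
    (hcov : ∀ i ∈ T.interferers j, ∀ d : Fin (Δ + 1), ∃ k, vec k = windowVec L comp pos i d) :
    Nonempty (SeparationCertificate T (windowVec (Δ := Δ) L comp pos) (sigmaSupport L t) j) := by
  obtain ⟨f, hf, hfm⟩ := exists_matching_sum _ _ hcard fun A hA =>
    (Nat.le_add_left _ _).trans (card_biUnion_windowVec (comp := comp) (pos := pos) ht j hA)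
  have hinj : Function.Injective (Sum.elim vec (windowVec (Δ := Δ) L comp pos j)) :=
    hvec.sumElim (windowVec_injective ht j) hne
  exact ⟨{
    κ := κ
    vec := vec
    tx := fun _ => none
    f := f
    f_injective := hf
    f_mem := fun c => by have := hfm c; cases c <;> exact this
    mode := fun _ => false
    gain := fun _ _ => 1
    gain_eq_one := fun c => by cases c <;> rfl
    gain_eq_zero := fun c c' hc h => absurd (hinj h) hc
    covers := fun i hi d => by
      obtain ⟨k, hk⟩ := hcov i hi d
      exact ⟨k, hk, Or.inr ⟨rfl, false, fun _ _ => rfl⟩⟩ }⟩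

theorem nonempty_certificate_of_interferers_eq_empty {j : Fin K} (ht : ∀ c, IsSpread (t c))
    (hj : T.interferers j = ∅) :
    Nonempty (SeparationCertificate T (windowVec (Δ := Δ) L comp pos) (sigmaSupport L t) j) :=
  nonempty_certificate_of_const (κ := Empty) T ht Empty.elim (fun x => x.elim) (fun x => x.elim)
    (fun A hA => hA.elim fun x => x.elim) (by simp [hj])

/-- Interference from a different line or cycle. -/
theorem nonempty_certificate_of_external {j : Fin K} (ht : ∀ c, IsSpread (t c)) (c : ι)
    (hc : comp j ≠ c) (hcomp : ∀ i ∈ T.interferers j, comp i = c) (a : ZMod (L c))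
    (hcov : ∀ i ∈ T.interferers j, ∀ d : ℕ, d ≤ Δ → ∃ d' : ℕ, d' ≤ Δ + 1 ∧ pos c i + d = a + d') :
    Nonempty (SeparationCertificate T (windowVec (Δ := Δ) L comp pos) (sigmaSupport L t) j) := by
  refine nonempty_certificate_of_const (κ := Fin (Δ + 2)) T ht (fun d => ⟨c, a + (d : ℕ)⟩)
    (fun d d' h => ?_) (fun k d h => hc (congrArg Sigma.fst h).symm)
    (fun A hA => (ht c).card_biUnion_slotSupport_fin a le_rfl hA) fun i hi d => ?_
  · rw [Sigma.mk.injEq, heq_eq_eq] at h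
    exact Fin.ext ((ht c).add_natCast_injective a (by omega) (by omega) h.2)
  · obtain ⟨d', hd', h⟩ := hcov i hi d (by omega)
    refine ⟨⟨d', by omega⟩, ?_⟩
    obtain rfl := hcomp i hi
    rw [windowVec, h]

/-- A single interferer, possibly with the same vectors as the desired signal: match two copies of
the vectors and use one mode on the rows of either copy. -/
theorem nonempty_certificate_of_single {i j : Fin K} (ht : ∀ c, IsSpread (t c))
    (hj : T.interferers j = {i}) :
    Nonempty (SeparationCertificate T (windowVec (Δ := Δ) L comp pos) (sigmaSupport L t) j) := by
  classical
  have hij : i ≠ j := fun h => T.not_mem_self j (by simp [hj, h])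
  obtain ⟨f, hf, hfm⟩ := exists_matching_sum
    (fun d => sigmaSupport L t (windowVec L comp pos i d))
    (fun d => sigmaSupport L t (windowVec L comp pos j d))
    (fun A hA => card_biUnion_windowVec ht i hA)
    fun A hA => (Nat.le_add_left _ _).trans (card_biUnion_windowVec ht j hA)
  have hmode : ∀ c, (decide (∃ d, f (Sum.inl d) = f c)) = c.isLeft := by
    rintro (d | d) <;> simp [hf.eq_iff]
  exact ⟨{
    κ := Fin (Δ + 1)
    vec := windowVec L comp pos i
    tx := fun _ => some i
    f := f
    f_injective := hf
    f_mem := fun c => by have := hfm c; cases c <;> exact this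
    mode := fun s => decide (∃ d, f (Sum.inl d) = s)
    gain := fun b k => if b = decide (k ≠ j) then 1 else 0
    gain_eq_one := fun c => by
      rw [hmode]; cases c <;> simp [extendedGain, hij]
    gain_eq_zero := fun c c' hc h => by
      rw [hmode]
      rcases c with c | c <;> rcases c' with c' | c'
      · exact absurd (congrArg Sum.inl (windowVec_injective ht i h)) hc
      · simp [extendedGain, hij]
      · simp [extendedGain]
      · exact absurd (congrArg Sum.inr (windowVec_injective ht j h)) hc
    covers := fun k hk d => by
      rw [hj, Finset.mem_singleton] at hk
      subst hk
      exact ⟨d, rfl, Or.inl rfl⟩ }⟩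

/-- Two consecutive interferers `i` and `i'` on the line or cycle of the receiver, at the positions
`x` and `x + 1`. The `Δ` vectors shared by both vanish at the channel uses `t x` and `t (x + 1)`,
where the second mode is used; so they stay aligned. The other vector of either interferer is not
zero on one of these channel uses, and there it can be told from the same vector in the desired
signal, if it is one of the desired vectors. -/
theorem nonempty_certificate_of_internal {i i' j : Fin K} (ht : ∀ c, IsSpread (t c)) (hΔ : 1 ≤ Δ)
    (hj : T.interferers j = {i, i'}) (c : ι) (hi : comp i = c) (hi' : comp i' = c)
    (hjc : comp j = c) (hpos : pos c i' = pos c i + 1)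
    (hsep : ∀ d b : ℕ, d < Δ → b ≤ Δ → pos c i + ((d + 1 : ℕ) : ZMod (L c)) ≠ pos c j + b) :
    Nonempty (SeparationCertificate T (windowVec (Δ := Δ) L comp pos) (sigmaSupport L t) j) := by
  classical
  have hij : i ≠ j := fun h => T.not_mem_self j (by simp [hj, h])
  have hij' : i' ≠ j := fun h => T.not_mem_self j (by simp [hj, h])
  set x := pos c i with hx
  have hwi : ∀ d : Fin (Δ + 1), windowVec L comp pos i d = ⟨c, x + (d : ℕ)⟩ := fun d => by
    subst hi; rfl
  have hwi' : ∀ d : Fin (Δ + 1), windowVec L comp pos i' d = ⟨c, x + ((d + 1 : ℕ) : ZMod (L c))⟩ :=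
    fun d => by
      subst hi'
      rw [windowVec, hpos]
      congr 1
      push_cast
      ring
  have hwj : ∀ d : Fin (Δ + 1), windowVec L comp pos j d = ⟨c, pos c j + (d : ℕ)⟩ := fun d => by
    subst hjc; rfl
  let S : Fin Δ → Finset (Fin (2 * Δ + 3)) := fun d => slotSupport (t c) (x + 1 + (d : ℕ))
  let Sj : Fin (Δ + 1) → Finset (Fin (2 * Δ + 3)) :=
    fun d => sigmaSupport L t (windowVec L comp pos j d)
  have hS : ∀ d : Fin Δ, ∀ s ∈ S d, s ≠ t c x ∧ s ≠ t c (x + 1) := by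
    refine fun d s hs => ⟨?_, ?_⟩ <;> rintro rfl
    · refine IsSpread.notMem_slotSupport_add (t := t c) x (d := d + 1) (by omega) ?_
      convert hs using 2
      push_cast
      ring
    · exact IsSpread.notMem_slotSupport_add (t := t c) (x + 1) (d := d) (by omega) hs
  obtain ⟨f, hf, hfm⟩ := exists_matching_sum S (fun d => Sj d \ {t c x, t c (x + 1)})
    (fun A hA => (ht c).card_biUnion_slotSupport_fin (x + 1) (by omega) hA) fun A hA => by
      have h1 : Δ + 1 + A.card ≤ (A.biUnion Sj).card := card_biUnion_windowVec ht j hA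
      have h2 : A.biUnion Sj \ {t c x, t c (x + 1)} ⊆
          A.biUnion fun d => Sj d \ {t c x, t c (x + 1)} := fun s hs => by
        simp only [Finset.mem_sdiff, Finset.mem_biUnion] at hs ⊢
        obtain ⟨⟨d, hd, hsd⟩, hs⟩ := hs
        exact ⟨d, hd, hsd, hs⟩
      have h3 := Finset.card_le_card h2
      have h4 := Finset.le_card_sdiff ({t c x, t c (x + 1)} : Finset (Fin (2 * Δ + 3)))
        (A.biUnion Sj)
      have h5 := Finset.card_le_two (a := t c x) (b := t c (x + 1))
      omega
  have hfne : ∀ q, f q ≠ t c x ∧ f q ≠ t c (x + 1) := by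
    rintro (q | q)
    · exact hS q _ (hfm (Sum.inl q))
    · have := (Finset.mem_sdiff.mp (hfm (Sum.inr q))).2
      simpa using this
  let vec : Fin Δ ⊕ Bool → Σ c, ZMod (L c) := Sum.elim
    (fun d => ⟨c, x + ((d + 1 : ℕ) : ZMod (L c))⟩)
    fun b => ⟨c, x + ((bif b then Δ + 1 else 0 : ℕ) : ZMod (L c))⟩
  let F : (Fin Δ ⊕ Bool) ⊕ Fin (Δ + 1) → Fin (2 * Δ + 3) := Sum.elim
    (Sum.elim (fun d => f (Sum.inl d)) fun b => bif b then t c x else t c (x + 1))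
    fun d => f (Sum.inr d)
  have hvec : Function.Injective vec := by
    have key : ∀ d d' : ℕ, d ≤ Δ + 1 → d' ≤ Δ + 1 →
        (⟨c, x + (d : ZMod (L c))⟩ : Σ c, ZMod (L c)) = ⟨c, x + (d' : ZMod (L c))⟩ → d = d' := by
      intro d d' hd hd' h
      rw [Sigma.mk.injEq, heq_eq_eq] at h
      exact (ht c).add_natCast_injective x hd hd' h.2
    rintro (d | b) (d' | b') h
    · have := key _ _ (by omega) (by omega) h
      exact congrArg Sum.inl (Fin.ext (by omega))
    · have := key _ _ (by omega) (by cases b' <;> simp) h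
      cases b' <;> simp at this
      omega
    · have := key _ _ (by cases b <;> simp) (by omega) h
      cases b <;> simp at this
      omega
    · have := key _ _ (by cases b <;> simp) (by cases b' <;> simp) h
      cases b <;> cases b' <;> simp at this ⊢
  let mode : Fin (2 * Δ + 3) → Bool := fun s => decide (s = t c x ∨ s = t c (x + 1))
  have hmode : ∀ q, mode (f q) = false := fun q => by
    simpa [mode] using hfne q
  have hmode' : ∀ b, mode (F (Sum.inl (Sum.inr b))) = true := fun b => by
    cases b <;> simp [mode, F]
  exact ⟨{
    κ := Fin Δ ⊕ Bool
    vec := vec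
    tx := Sum.elim (fun _ => none) fun b => some (bif b then i' else i)
    f := F
    f_injective := by
      have hne := (ht c).apply_add_one_ne x
      rintro ((q | q) | q) ((q' | q') | q') h
      · exact congrArg (Sum.inl ∘ Sum.inl) (Sum.inl_injective (hf h))
      · cases q'
        · exact absurd h (hfne _).2
        · exact absurd h (hfne _).1
      · simpa using hf h
      · cases q
        · exact absurd h.symm (hfne _).2
        · exact absurd h.symm (hfne _).1
      · cases q <;> cases q' <;> simp [F, hne, hne.symm] at h ⊢
      · cases q
        · exact absurd h.symm (hfne _).2
        · exact absurd h.symm (hfne _).1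
      · simpa using hf h
      · cases q'
        · exact absurd h (hfne _).2
        · exact absurd h (hfne _).1
      · exact congrArg Sum.inr (Sum.inr_injective (hf h))
    f_mem := by
      rintro ((q | q) | q)
      · have : f (Sum.inl q) ∈ slotSupport (t c) (x + 1 + (q : ℕ)) := hfm (Sum.inl q)
        change f (Sum.inl q) ∈ slotSupport (t c) (x + ((q + 1 : ℕ) : ZMod (L c)))
        convert this using 2
        push_cast
        ring
      · cases q
        · change t c (x + 1) ∈ slotSupport (t c) (x + ((0 : ℕ) : ZMod (L c)))
          rw [Nat.cast_zero, add_zero]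
          exact (ht c).mem_slotSupport_sub_one x
        · exact (ht c).mem_slotSupport_add_succ x
      · exact (Finset.mem_sdiff.mp (hfm (Sum.inr q))).1
    mode := mode
    gain := fun b k => if b = decide (k ≠ j) then 1 else 0
    gain_eq_one := by
      rintro ((q | q) | q)
      · rfl
      · rw [hmode']; cases q <;> simp [extendedGain, hij, hij']
      · simp [extendedGain, F, hmode]
    gain_eq_zero := by
      have hoff : ∀ (q : Fin Δ) (b : Fin (Δ + 1)), vec (Sum.inl q) ≠ windowVec L comp pos j b := by
        intro q b h
        rw [hwj] at h
        simp only [vec, Sum.elim_inl, Sigma.mk.injEq, heq_eq_eq, true_and] at h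
        exact hsep q b q.2 (by omega) h
      rintro (q | q) (q' | q') hne h
      · exact absurd (congrArg Sum.inl (hvec h)) hne
      · rcases q with q | q
        · exact absurd h.symm (hoff q q')
        · have : mode (F (Sum.inr q')) = false := hmode _
          rw [this]
          cases q <;> simp [extendedGain, hij, hij']
      · rcases q' with q' | q'
        · exact absurd h (hoff q' q)
        · rw [hmode']; simp [extendedGain]
      · exact absurd (congrArg Sum.inr (windowVec_injective ht j h)) hne
    covers := by
      have hshared : ∀ d : Fin Δ, ∃ b, ∀ s ∈ sigmaSupport L t (vec (Sum.inl d)), mode s = b := by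
        refine fun d => ⟨false, fun s hs => ?_⟩
        have : s ∈ S d := by
          change s ∈ slotSupport (t c) (x + ((d + 1 : ℕ) : ZMod (L c))) at hs
          convert hs using 2
          push_cast
          ring
        simpa [mode] using hS d s this
      intro k hk d
      rw [hj, Finset.mem_insert, Finset.mem_singleton] at hk
      rcases hk with rfl | rfl
      · rw [hwi]
        rcases d with ⟨_ | d, hd⟩
        · exact ⟨Sum.inr false, rfl, Or.inl rfl⟩
        · exact ⟨Sum.inl ⟨d, by omega⟩, rfl, Or.inr ⟨rfl, hshared ⟨d, by omega⟩⟩⟩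
      · rw [hwi']
        by_cases hd : (d : ℕ) = Δ
        · exact ⟨Sum.inr true, by simp [vec, hd], Or.inl rfl⟩
        · exact ⟨Sum.inl ⟨d, by omega⟩, rfl, Or.inr ⟨rfl, hshared ⟨d, by omega⟩⟩⟩ }⟩

end Windows

/-! ### Graphs of maximum degree two -/

namespace SimpleGraph

variable {V : Type*} {G : SimpleGraph V}

theorem edist_le_of_chain {u : ℕ → V} {k s : ℕ}
    (h : ∀ l, k ≤ l → l < k + s → G.Adj (u l) (u (l + 1))) : G.edist (u k) (u (k + s)) ≤ s := by
  induction s with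
  | zero => simp
  | succ s ih =>
    refine (G.edist_triangle (v := u (k + s))).trans ?_
    rw [Nat.cast_succ]
    exact add_le_add (ih fun l h1 h2 => h l h1 (by omega))
      (edist_eq_one_iff_adj.mpr (h (k + s) (by omega) (by omega))).le

/-- In a finite graph of maximum degree at most two, a path of maximal length through a connected
component contains the whole component, and its vertices are adjacent only to the previous and the
next ones, except that its two ends may be adjacent. -/
theorem exists_spanning_path [Finite V]
    (hdeg : ∀ x a b c, G.Adj x a → G.Adj x b → G.Adj x c → a = b ∨ a = c ∨ b = c) (v : V) :
    ∃ (u : ℕ → V) (n : ℕ), Set.InjOn u (Set.Iic n) ∧ (∀ k < n, G.Adj (u k) (u (k + 1))) ∧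
      (∀ y, G.Reachable v y → ∃ k ≤ n, u k = y) ∧
      ∀ k ≤ n, ∀ l ≤ n, G.Adj (u k) (u l) →
        l = k + 1 ∨ k = l + 1 ∨ (k = 0 ∧ l = n) ∨ (k = n ∧ l = 0) := by
  classical
  have := Fintype.ofFinite V
  let Q : ℕ → Prop := fun n => ∃ u : ℕ → V, Set.InjOn u (Set.Iic n) ∧
    (∀ k < n, G.Adj (u k) (u (k + 1))) ∧ ∀ k ≤ n, G.Reachable v (u k)
  have hQ0 : Q 0 := ⟨fun _ => v, fun a ha b hb _ => by simp at ha hb; omega, by simp,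
    fun _ _ => Reachable.refl v⟩
  have hQb : ∀ n, Q n → n ≤ Fintype.card V := by
    rintro n ⟨u, hu, -⟩
    have := Finset.card_le_card_of_injOn (s := Finset.Iic n) (t := Finset.univ) u (by simp)
      (by simpa using hu)
    simp at this
    omega
  obtain ⟨n, ⟨u, hinj, hadj, hreach⟩, hmax⟩ : ∃ n, Q n ∧ ∀ m, Q m → m ≤ n :=
    ⟨_, Nat.findGreatest_spec (Nat.zero_le _) hQ0, fun m hm => Nat.le_findGreatest (hQb m hm) hm⟩
  have hfront : ∀ y, G.Adj (u 0) y → ∃ l ≤ n, u l = y := by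
    intro y hy
    by_contra! hcon
    have : Q (n + 1) := by
      refine ⟨fun k => Nat.casesOn k y u, ?_, ?_, ?_⟩
      · rintro (_ | a) ha (_ | b) hb h
        · rfl
        · exact absurd h.symm (hcon b (by simpa using hb))
        · exact absurd h (hcon a (by simpa using ha))
        · exact congrArg _ (hinj (by simpa using ha) (by simpa using hb) h)
      · rintro (_ | k) hk
        · exact hy.symm
        · exact hadj k (by omega)
      · rintro (_ | k) hk
        · exact (hreach 0 (Nat.zero_le _)).trans hy.reachable
        · exact hreach k (by omega)
    have := hmax _ this
    omega
  have hback : ∀ y, G.Adj (u n) y → ∃ l ≤ n, u l = y := by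
    intro y hy
    by_contra! hcon
    have : Q (n + 1) := by
      refine ⟨fun k => if k ≤ n then u k else y, ?_, ?_, ?_⟩
      · intro a ha b hb h
        simp only [Set.mem_Iic] at ha hb
        dsimp only at h
        split_ifs at h with h1 h2 h2
        · exact hinj h1 h2 h
        · exact absurd h (hcon a h1)
        · exact absurd h.symm (hcon b h2)
        · omega
      · intro k hk
        dsimp only
        rw [if_pos (by omega)]
        split_ifs with h1
        · exact hadj k (by omega)
        · obtain rfl : k = n := by omega
          exact hy
      · intro k hk
        dsimp only
        split_ifs with h1
        · exact hreach k h1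
        · exact (hreach n le_rfl).trans hy.reachable
    have := hmax _ this
    omega
  have hmid : ∀ k, 0 < k → k < n → ∀ y, G.Adj (u k) y → y = u (k - 1) ∨ y = u (k + 1) := by
    intro k h0 hn y hy
    have h1 : G.Adj (u k) (u (k - 1)) := by
      have := hadj (k - 1) (by omega)
      rw [Nat.sub_add_cancel h0] at this
      exact this.symm
    rcases hdeg _ _ _ _ hy h1 (hadj k hn) with h | h | h
    · exact Or.inl h
    · exact Or.inr h
    · have := hinj (by simp; omega) (by simp; omega) h
      omega
  have hnbr : ∀ k ≤ n, ∀ l ≤ n, G.Adj (u k) (u l) →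
      l = k + 1 ∨ k = l + 1 ∨ (k = 0 ∧ l = n) ∨ (k = n ∧ l = 0) := by
    have hmid' : ∀ k, 0 < k → k < n → ∀ l ≤ n, G.Adj (u k) (u l) → l = k + 1 ∨ k = l + 1 := by
      intro k h0 hn l hl h
      rcases hmid k h0 hn _ h with h | h
      · have := hinj (Set.mem_Iic.mpr hl) (Set.mem_Iic.mpr (by omega)) h
        omega
      · have := hinj (Set.mem_Iic.mpr hl) (Set.mem_Iic.mpr (by omega)) h
        omega
    intro k hk l hl h
    have hkl : k ≠ l := fun hkl => h.ne (congrArg u hkl)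
    by_cases hk' : 0 < k ∧ k < n
    · have := hmid' k hk'.1 hk'.2 l hl h
      omega
    by_cases hl' : 0 < l ∧ l < n
    · have := hmid' l hl'.1 hl'.2 k hk h.symm
      omega
    omega
  refine ⟨u, n, hinj, hadj, fun y hy => ?_, hnbr⟩
  have hy' : G.Reachable (u 0) y := (hreach 0 (Nat.zero_le _)).symm.trans hy
  rw [reachable_iff_reflTransGen] at hy'
  induction hy' with
  | refl => exact ⟨0, Nat.zero_le _, rfl⟩
  | @tail b c hb hbc ih =>
    obtain ⟨k, hk, rfl⟩ := ih (hy.trans hbc.symm.reachable)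
    by_cases h0 : k = 0
    · subst h0; exact hfront _ hbc
    by_cases hn : k = n
    · subst hn; exact hback _ hbc
    rcases hmid k (by omega) (by omega) _ hbc with h | h
    · exact ⟨k - 1, by omega, h.symm⟩
    · exact ⟨k + 1, by omega, h.symm⟩

/-- In a finite graph of maximum degree at most two, every component can be laid out along a cycle:
a component that is a path is embedded in a cycle so long that its ends remain further apart than
`D`. The last clause bounds distances by differences of positions: for differences below `D`, and
for all differences if `L < D + 2`, when the component is itself the cycle. -/
theorem exists_cyclic_position [Finite V]
    (hdeg : ∀ x a b c, G.Adj x a → G.Adj x b → G.Adj x c → a = b ∨ a = c ∨ b = c) (v : V) (D : ℕ) :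
    ∃ (L : ℕ) (pos : V → ZMod L), 0 < L ∧
      (∀ x y, G.Reachable v x → G.Reachable v y → G.Adj x y → pos y = pos x + 1 ∨ pos x = pos y + 1) ∧
      (∀ x y, G.Reachable v x → G.Reachable v y → ∀ s : ℕ, (s < D ∨ L < D + 2) →
        pos y = pos x + s → G.edist x y ≤ s) := by
  classical
  obtain ⟨u, n, hinj, hadj, hsurj, hnbr⟩ := exists_spanning_path hdeg v
  let idx : V → ℕ := fun y => if h : ∃ k ≤ n, u k = y then h.choose else 0
  have hidx : ∀ y, G.Reachable v y → idx y ≤ n ∧ u (idx y) = y := fun y hy => by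
    have h := hsurj y hy
    simp only [idx, dif_pos h]
    exact h.choose_spec
  by_cases hcyc : 2 ≤ n ∧ G.Adj (u n) (u 0)
  · refine ⟨n + 1, fun y => (idx y : ZMod (n + 1)), by omega, fun x y hx hy hxy => ?_,
      fun x y hx hy s _ hs => ?_⟩
    · have hn : ((n + 1 : ℕ) : ZMod (n + 1)) = 0 := ZMod.natCast_self _
      rw [Nat.cast_succ] at hn
      obtain ⟨h1, h2⟩ := hidx x hx
      obtain ⟨h3, h4⟩ := hidx y hy
      rw [← h2, ← h4] at hxy
      rcases hnbr _ h1 _ h3 hxy with h | h | ⟨h, h'⟩ | ⟨h, h'⟩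
      · left; dsimp only; rw [h]; push_cast; ring
      · right; dsimp only; rw [h]; push_cast; ring
      · right; dsimp only; rw [h, h', hn, Nat.cast_zero]
      · left; dsimp only; rw [h, h', hn, Nat.cast_zero]
    · obtain ⟨h1, h2⟩ := hidx x hx
      obtain ⟨h3, h4⟩ := hidx y hy
      have hmod : ∀ l, G.Adj (u (l % (n + 1))) (u ((l + 1) % (n + 1))) := by
        intro l
        have hl : l % (n + 1) < n + 1 := Nat.mod_lt l (by omega)
        by_cases h : l % (n + 1) = n
        · have : (l + 1) % (n + 1) = 0 := by rw [Nat.add_mod, h]; simp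
          rw [this, h]
          exact hcyc.2
        · have : (l + 1) % (n + 1) = l % (n + 1) + 1 := by
            rw [Nat.add_mod, Nat.mod_eq_of_lt (a := 1) (by omega), Nat.mod_eq_of_lt (by omega)]
          rw [this]
          exact hadj _ (by omega)
      have := edist_le_of_chain (G := G) (u := fun l => u (l % (n + 1))) (k := idx x) (s := s)
        fun l _ _ => hmod l
      have hs' : (idx x + s) % (n + 1) = idx y := by
        rw [← Nat.cast_add, ZMod.natCast_eq_natCast_iff'] at hs
        rw [← hs, Nat.mod_eq_of_lt (by omega)]
      simp only [hs', Nat.mod_eq_of_lt (Nat.lt_succ_of_le h1), h2, h4] at this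
      exact this
  · refine ⟨n + D + 2, fun y => (idx y : ZMod (n + D + 2)), by omega, fun x y hx hy hxy => ?_,
      fun x y hx hy s hsD hs => ?_⟩
    · obtain ⟨h1, h2⟩ := hidx x hx
      obtain ⟨h3, h4⟩ := hidx y hy
      rw [← h2, ← h4] at hxy
      have : idx y = idx x + 1 ∨ idx x = idx y + 1 := by
        rcases hnbr _ h1 _ h3 hxy with h | h | ⟨h, h'⟩ | ⟨h, h'⟩
        · exact Or.inl h
        · exact Or.inr h
        · rw [h, h'] at hxy ⊢
          have : n ≠ 0 := fun h0 => hxy.ne (by rw [h0])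
          have : ¬ 2 ≤ n := fun h2 => hcyc ⟨h2, hxy.symm⟩
          omega
        · rw [h, h'] at hxy ⊢
          have : n ≠ 0 := fun h0 => hxy.ne (by rw [h0])
          have : ¬ 2 ≤ n := fun h2 => hcyc ⟨h2, hxy⟩
          omega
      rcases this with h | h
      · left; dsimp only; rw [h]; push_cast; ring
      · right; dsimp only; rw [h]; push_cast; ring
    · obtain ⟨h1, h2⟩ := hidx x hx
      obtain ⟨h3, h4⟩ := hidx y hy
      have hs' : idx y = idx x + s := by
        rw [← Nat.cast_add, ZMod.natCast_eq_natCast_iff', Nat.mod_eq_of_lt (by omega),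
          Nat.mod_eq_of_lt (by omega)] at hs
        exact hs
      have := edist_le_of_chain (G := G) (u := u) (k := idx x) (s := s)
        fun l _ h => hadj l (by omega)
      rwa [← hs', h2, h4] at this

end SimpleGraph

/-! ### Layout of the alignment graph -/

namespace NetworkTopology

variable {K : ℕ} (T : NetworkTopology K)

theorem mem_coInterferers {i a : Fin K} : a ∈ T.coInterferers i ↔ T.alignmentGraph.Adj i a := by
  simp only [coInterferers, alignmentGraph, Finset.mem_biUnion, Finset.mem_filter,
    Finset.mem_univ, true_and, Finset.mem_sdiff, Finset.mem_singleton]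
  constructor
  · rintro ⟨k, h1, h2, h3⟩
    exact ⟨fun h => h3 h.symm, k, h1, h2⟩
  · rintro ⟨h3, k, h1, h2⟩
    exact ⟨k, h1, h2, fun h => h3 h.symm⟩

theorem alignmentGraph_adj_of_mem {i i' k : Fin K} (hi : i ∈ T.interferers k)
    (hi' : i' ∈ T.interferers k) (h : i ≠ i') : T.alignmentGraph.Adj i i' :=
  ⟨h, k, hi, hi'⟩

theorem sameAlignmentSet_of_mem {i i' k : Fin K} (hi : i ∈ T.interferers k)
    (hi' : i' ∈ T.interferers k) : T.alignmentGraph.Reachable i i' := by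
  by_cases h : i = i'
  · rw [h]
  · exact (T.alignmentGraph_adj_of_mem hi hi' h).reachable

theorem alignmentGraph_neighbors (hT : ∀ i, (T.coInterferers i).card ≤ 2) (x a b c : Fin K)
    (ha : T.alignmentGraph.Adj x a) (hb : T.alignmentGraph.Adj x b)
    (hc : T.alignmentGraph.Adj x c) : a = b ∨ a = c ∨ b = c := by
  by_contra! h
  have := Finset.two_lt_card.mpr ⟨a, T.mem_coInterferers.mpr ha, b, T.mem_coInterferers.mpr hb, c,
    T.mem_coInterferers.mpr hc, h.1, h.2.1, h.2.2⟩
  have := hT x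
  omega

/-- A receiver with two or more interferers, all of them in its own alignment set, is a vertex with
multiple internal conflicts. -/
theorem mem_multiConflictVertices {j i i' : Fin K} (hi : i ∈ T.interferers j)
    (hi' : i' ∈ T.interferers j) (hne : i ≠ i') (hij : T.alignmentGraph.Reachable i j) :
    j ∈ T.multiConflictVertices := by
  refine (Set.one_lt_ncard (Set.toFinite _)).mpr ⟨i, ⟨hi, hij⟩, i', ⟨hi', ?_⟩, hne⟩
  exact (T.sameAlignmentSet_of_mem hi' hi).trans hij

/-- Every connected component of the alignment graph has a layout on a cycle in which the windows of
the interferers of any receiver lie in a window of length `Δ + 2`, and the interferers inside the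
component of a receiver with multiple internal conflicts are two consecutive vertices whose shared
vectors are not used by the transmitter of the receiver. In components without such receivers all
the positions can be taken equal. -/
theorem exists_layout (hT : ∀ i, (T.coInterferers i).card ≤ 2) {Δ : ℕ} (hΔ : 1 ≤ Δ)
    (hB : ∀ j ∈ T.multiConflictVertices, ∀ i, T.InternalConflict i j →
      (Δ : ℕ∞) ≤ T.conflictDistance i j) (v : Fin K) :
    ∃ (L : ℕ) (pos : Fin K → ZMod L), Δ + 2 ≤ L ∧
      (∀ k, (∀ i ∈ T.interferers k, T.alignmentGraph.Reachable v i) →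
        ∃ a, ∀ i ∈ T.interferers k, ∀ d : ℕ, d ≤ Δ → ∃ d' : ℕ, d' ≤ Δ + 1 ∧ pos i + d = a + d') ∧
      ∀ j i i', T.alignmentGraph.Reachable v j → i ∈ T.interferers j → i' ∈ T.interferers j →
        i ≠ i' → T.alignmentGraph.Reachable v i →
        ∃ i i', T.interferers j = {i, i'} ∧ pos i' = pos i + 1 ∧
          ∀ d b : ℕ, d < Δ → b ≤ Δ → pos i + ((d + 1 : ℕ) : ZMod L) ≠ pos j + b := by
  classical
  by_cases hmulti : ∃ j i i', T.alignmentGraph.Reachable v j ∧ i ∈ T.interferers j ∧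
      i' ∈ T.interferers j ∧ i ≠ i' ∧ T.alignmentGraph.Reachable v i
  swap
  · refine ⟨Δ + 2, fun _ => 0, le_rfl, fun k _ => ⟨0, fun i _ d hd => ⟨d, by omega, rfl⟩⟩,
      fun j i i' h1 h2 h3 h4 h5 => absurd ⟨j, i, i', h1, h2, h3, h4, h5⟩ hmulti⟩
  obtain ⟨L, pos, hL0, hpos, hdist⟩ := SimpleGraph.exists_cyclic_position
    (T.alignmentGraph_neighbors hT) v Δ
  have := NeZero.of_pos hL0
  have hinj : ∀ x y, T.alignmentGraph.Reachable v x → T.alignmentGraph.Reachable v y →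
      pos x = pos y → x = y := fun x y hx hy h => by
    have := hdist x y hx hy 0 (Or.inl hΔ) (by simp [h])
    simpa using this
  -- interferers of a receiver are pairwise consecutive
  have hcons : ∀ k i i', i ∈ T.interferers k → i' ∈ T.interferers k → i ≠ i' →
      T.alignmentGraph.Reachable v i → ∃ x ∈ T.interferers k, ∃ y ∈ T.interferers k,
        x ≠ y ∧ pos y = pos x + 1 := fun k i i' hi hi' hne hvi => by
    rcases hpos i i' hvi (hvi.trans (T.sameAlignmentSet_of_mem hi hi'))
      (T.alignmentGraph_adj_of_mem hi hi' hne) with h | h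
    · exact ⟨i, hi, i', hi', hne, h⟩
    · exact ⟨i', hi', i, hi, hne.symm, h⟩
  have hfar : ∀ j x, T.alignmentGraph.Reachable v j → j ∈ T.multiConflictVertices →
      x ∈ T.interferers j → T.alignmentGraph.Reachable v x →
      (Δ : ℕ∞) ≤ T.alignmentGraph.edist x j := fun j x hj hjB hx hvx =>
    hB j hjB x ⟨hx, hvx.symm.trans hj⟩
  -- a shorter cycle has no vertex far enough from two consecutive interferers
  have hL : Δ + 2 ≤ L := by
    by_contra hlt
    obtain ⟨j, i, i', hvj, hi, hi', hne, hvi⟩ := hmulti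
    have hjB := T.mem_multiConflictVertices hi hi' hne (hvi.symm.trans hvj)
    obtain ⟨x, hx, y, hy, -, hxy⟩ := hcons j i i' hi hi' hne hvi
    have hvx := hvi.trans (T.sameAlignmentSet_of_mem hi hx)
    have hvy := hvi.trans (T.sameAlignmentSet_of_mem hi hy)
    have hs : pos j = pos y + ((pos j - pos y).val : ℕ) := by
      rw [ZMod.natCast_zmod_val]; ring
    have hlt' := ZMod.val_lt (pos j - pos y)
    have h1 := (hfar j y hvj hjB hy hvy).trans (hdist y j hvy hvj _ (Or.inr (by omega)) hs)
    rw [Nat.cast_le] at h1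
    -- the only remaining position of `j` is that of `x`
    have h2 : (pos j - pos y).val + 1 = L := by omega
    have h3 : (((pos j - pos y).val + 1 : ℕ) : ZMod L) = 0 := by rw [h2, ZMod.natCast_self]
    rw [Nat.cast_succ, ZMod.natCast_zmod_val] at h3
    refine T.not_mem_self j (hinj x j hvx hvj ?_ ▸ hx)
    linear_combination -h3 - hxy
  -- three interferers of one receiver form a triangle
  have hthree : ∀ k x y z, x ∈ T.interferers k → y ∈ T.interferers k → z ∈ T.interferers k →
      T.alignmentGraph.Reachable v x → pos y = pos x + 1 → x ≠ y → z ≠ x → z ≠ y → L = 3 := by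
    intro k x y z hx hy hz hvx hxy hne hzx hzy
    have hvy := hvx.trans (T.sameAlignmentSet_of_mem hx hy)
    have hvz := hvx.trans (T.sameAlignmentSet_of_mem hx hz)
    have h3 : ((3 : ℕ) : ZMod L) = 0 := by
      rcases hpos z x hvz hvx (T.alignmentGraph_adj_of_mem hz hx hzx) with h | h
      · rcases hpos z y hvz hvy (T.alignmentGraph_adj_of_mem hz hy hzy) with h' | h'
        · exact absurd (hinj x y hvx hvy (by rw [h, h'])) hne
        · push_cast
          linear_combination -h - h' - hxy
      · exact absurd (hinj z y hvz hvy (by rw [h, hxy])) hzy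
    rw [ZMod.natCast_eq_zero_iff] at h3
    have := Nat.le_of_dvd (by omega) h3
    omega
  refine ⟨L, pos, hL, fun k hk => ?_, fun j i i' hvj hi hi' hne hvi => ?_⟩
  · by_cases hsub : ∃ i ∈ T.interferers k, ∃ i' ∈ T.interferers k, i ≠ i'
    · obtain ⟨i, hi, i', hi', hne⟩ := hsub
      obtain ⟨x, hx, y, hy, hne, hxy⟩ := hcons k i i' hi hi' hne (hk i hi)
      refine ⟨pos x, fun z hz d hd => ?_⟩
      by_cases hzx : z = x
      · exact ⟨d, by omega, by rw [hzx]⟩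
      by_cases hzy : z = y
      · exact ⟨d + 1, by omega, by rw [hzy, hxy]; push_cast; ring⟩
      have h3 := hthree k x y z hx hy hz (hk x hx) hxy hne hzx hzy
      have := ZMod.val_lt (pos z + (d : ZMod L) - pos x)
      refine ⟨(pos z + (d : ZMod L) - pos x).val, by omega, ?_⟩
      rw [ZMod.natCast_zmod_val]
      ring
    · push Not at hsub
      by_cases hne : (T.interferers k).Nonempty
      · obtain ⟨x, hx⟩ := hne
        exact ⟨pos x, fun z hz d hd => ⟨d, by omega, by rw [hsub z hz x hx]⟩⟩
      · exact ⟨0, fun z hz => absurd ⟨z, hz⟩ hne⟩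
  · have hjB := T.mem_multiConflictVertices hi hi' hne (hvi.symm.trans hvj)
    obtain ⟨x, hx, y, hy, hne, hxy⟩ := hcons j i i' hi hi' hne hvi
    have hvx := hvi.trans (T.sameAlignmentSet_of_mem hi hx)
    have hvy := hvi.trans (T.sameAlignmentSet_of_mem hi hy)
    have hxj := hfar j x hvj hjB hx hvx
    have hyj := hfar j y hvj hjB hy hvy
    refine ⟨x, y, ?_, hxy, fun d b hd hb h => ?_⟩
    · ext z
      rw [Finset.mem_insert, Finset.mem_singleton]
      refine ⟨fun hz => ?_, by rintro (rfl | rfl) <;> assumption⟩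
      by_contra! hcon
      -- a component that is a triangle has no further vertex `j`
      have h3 := hthree j x y z hx hy hz hvx hxy hne hcon.1 hcon.2
      subst h3
      have hvz := hvx.trans (T.sameAlignmentSet_of_mem hx hz)
      have hzx : pos z ≠ pos x := fun h => hcon.1 (hinj _ _ hvz hvx h)
      have hzy : pos z ≠ pos y := fun h => hcon.2 (hinj _ _ hvz hvy h)
      have hjx : pos j ≠ pos x := fun h => T.not_mem_self j (hinj _ _ hvj hvx h ▸ hx)
      have hjy : pos j ≠ pos y := fun h => T.not_mem_self j (hinj _ _ hvj hvy h ▸ hy)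
      have hjz : pos j ≠ pos z := fun h => T.not_mem_self j (hinj _ _ hvj hvz h ▸ hz)
      have key : ∀ p q r : ZMod 3, q ≠ p → q ≠ p + 1 → r ≠ p → r ≠ p + 1 → r = q := by decide
      rw [hxy] at hzy hjy
      exact hjz (key _ _ _ hzx hzy hjx hjy)
    · rcases le_or_gt b d with hbd | hbd
      · have := hyj.trans (hdist y j hvy hvj (d - b) (Or.inl (by omega)) (by
          rw [Nat.cast_sub hbd]; push_cast at h; linear_combination -h - hxy))
        rw [Nat.cast_le] at this
        omega
      · rw [SimpleGraph.edist_comm] at hxj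
        have := hxj.trans (hdist j x hvj hvx (b - d - 1) (Or.inl (by omega)) (by
          rw [Nat.sub_sub, Nat.cast_sub (by omega)]; linear_combination h))
        rw [Nat.cast_le] at this
        omega

end NetworkTopology

/-- The linear scheme over `2Δ + 3` channel uses, for any `Δ` that does not exceed the conflict
distances towards the receivers with multiple internal conflicts. -/
theorem NetworkTopology.exists_linearScheme {K : ℕ} (T : NetworkTopology K) (M : Fin K → ℕ)
    (hM : ∀ j, 2 ≤ M j) (hT : ∀ i, (T.coInterferers i).card ≤ 2) {Δ : ℕ} (hΔ : 1 ≤ Δ)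
    (hB : ∀ j ∈ T.multiConflictVertices, ∀ i, T.InternalConflict i j →
      (Δ : ℕ∞) ≤ T.conflictDistance i j) :
    ∃ σ : LinearScheme K M (2 * Δ + 3),
      (∀ i, σ.numSymbols i = Δ + 1) ∧ σ.Secures T (fun _ => Δ + 1) := by
  classical
  let ι := T.alignmentGraph.ConnectedComponent
  let comp : Fin K → ι := T.alignmentGraph.connectedComponentMk
  have hrep : ∀ (c : ι) (x : Fin K), T.alignmentGraph.Reachable c.out x ↔ comp x = c := by
    intro c x
    rw [← SimpleGraph.ConnectedComponent.eq, eq_comm]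
    exact Eq.congr_right c.out_eq
  have hsame : ∀ {k i i'}, i ∈ T.interferers k → i' ∈ T.interferers k → comp i = comp i' :=
    fun hi hi' => SimpleGraph.ConnectedComponent.eq.mpr (T.sameAlignmentSet_of_mem hi hi')
  choose L pos hL hcov hint using fun c : ι => T.exists_layout hT hΔ hB c.out
  choose t ht using fun c : ι => exists_isSpread (hL c)
  refine exists_linearScheme_of_certificates T M hM (windowVec L comp pos) (sigmaSupport L t)
    fun j => Classical.choice ?_
  rcases (T.interferers j).eq_empty_or_nonempty with hj | ⟨i, hi⟩
  · exact nonempty_certificate_of_interferers_eq_empty T ht hj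
  by_cases hsing : ∃ i' ∈ T.interferers j, i ≠ i'
  swap
  · refine nonempty_certificate_of_single T (i := i) ht (Finset.eq_singleton_iff_unique_mem.mpr
      ⟨hi, fun i' hi' => ?_⟩)
    by_contra hne
    exact hsing ⟨i', hi', Ne.symm hne⟩
  obtain ⟨i', hi', hne⟩ := hsing
  by_cases hij : comp j = comp i
  · obtain ⟨x, y, hxy, hpos, hsep⟩ := hint (comp j) j i i' ((hrep _ _).mpr rfl) hi hi' hne
      ((hrep _ _).mpr hij.symm)
    exact nonempty_certificate_of_internal T ht hΔ hxy (comp j)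
      ((hsame (by simp [hxy]) hi).trans hij.symm) ((hsame (by simp [hxy]) hi).trans hij.symm) rfl
      hpos hsep
  · obtain ⟨a, ha⟩ := hcov (comp i) j fun k hk => (hrep _ _).mpr (hsame hk hi)
    exact nonempty_certificate_of_external T ht (comp i) hij (fun k hk => hsame hk hi) a ha

/-! ### Repetition of schemes and limits -/

namespace LinearScheme

variable {K m₀ : ℕ} {M : Fin K → ℕ}

/-- The scheme that repeats a scheme `q` times over consecutive blocks of channel uses, each time
with new symbols, and sends nothing in the channel uses that are left. -/
def repeated (σ : LinearScheme K M m₀) (hm₀ : 0 < m₀) (q m : ℕ) : LinearScheme K M m where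
  numSymbols i := q * σ.numSymbols i
  beam i := Matrix.of fun s c =>
    if (s : ℕ) / m₀ = c.divNat then σ.beam i ⟨s % m₀, Nat.mod_lt _ hm₀⟩ c.modNat else 0
  mode j s := σ.mode j ⟨s % m₀, Nat.mod_lt _ hm₀⟩

variable (σ : LinearScheme K M m₀) (hm₀ : 0 < m₀) {q m : ℕ}

theorem mul_desiredDim_le_desiredDim_repeated (hqm : q * m₀ ≤ m) (T : NetworkTopology K)
    (h : ChannelGains K M) (j : Fin K) :
    q * σ.desiredDim T h j ≤ (σ.repeated hm₀ q m).desiredDim T h j := by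
  classical
  let σ' := σ.repeated hm₀ q m
  have hlt : ∀ (b : Fin q) (r : Fin m₀), (b : ℕ) * m₀ + r < m := fun b r => by
    have : ((b : ℕ) + 1) * m₀ ≤ q * m₀ := Nat.mul_le_mul_right _ b.2
    have := r.2
    rw [Nat.succ_mul] at *
    omega
  -- restriction to a block
  let ρ : Fin q → EuclideanSpace ℂ (Fin m) →ₗ[ℂ] EuclideanSpace ℂ (Fin m₀) := fun b =>
    { toFun := fun x => WithLp.toLp 2 fun r => x ⟨b * m₀ + r, hlt b r⟩
      map_add' := fun x y => rfl
      map_smul' := fun a x => rfl }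
  let π : EuclideanSpace ℂ (Fin m₀) →ₗ[ℂ] EuclideanSpace ℂ (Fin m₀) :=
    ((σ.interferenceSpace T h j)ᗮ.starProjection : _ →L[ℂ] _).toLinearMap
  let φ : EuclideanSpace ℂ (Fin m) →ₗ[ℂ] (Fin q → EuclideanSpace ℂ (Fin m₀)) :=
    LinearMap.pi fun b => π ∘ₗ ρ b
  let col : ∀ i, Fin (σ.numSymbols i) → EuclideanSpace ℂ (Fin m₀) := fun i c =>
    WithLp.toLp 2 fun s => (σ.channelMatrix h j i * σ.beam i) s c
  let col' : ∀ i, Fin (q * σ.numSymbols i) → EuclideanSpace ℂ (Fin m) := fun i c =>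
    WithLp.toLp 2 fun s => (σ'.channelMatrix h j i * σ'.beam i) s c
  have hρ : ∀ i c b, ρ b (col' i c) = if b = c.divNat then col i c.modNat else 0 := by
    intro i c b
    have hdiv : ∀ r : Fin m₀, ((b : ℕ) * m₀ + r) / m₀ = b := fun r => by
      rw [mul_comm, Nat.mul_add_div hm₀, Nat.div_eq_of_lt r.2, add_zero]
    have hmod : ∀ r : Fin m₀, ((b : ℕ) * m₀ + r) % m₀ = r := fun r => by
      rw [mul_comm, Nat.mul_add_mod, Nat.mod_eq_of_lt r.2]
    ext r
    have hr : (⟨((b : ℕ) * m₀ + r) % m₀, Nat.mod_lt _ hm₀⟩ : Fin m₀) = r := Fin.ext (hmod r)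
    have h₁ : ρ b (col' i c) r =
        h j (σ.mode j ⟨((b : ℕ) * m₀ + r) % m₀, Nat.mod_lt _ hm₀⟩) i *
          (if ((b : ℕ) * m₀ + r) / m₀ = c.divNat then
            σ.beam i ⟨((b : ℕ) * m₀ + r) % m₀, Nat.mod_lt _ hm₀⟩ c.modNat else 0) :=
      Matrix.diagonal_mul ..
    have h₂ : col i c.modNat r = h j (σ.mode j r) i * σ.beam i r c.modNat :=
      Matrix.diagonal_mul ..
    rw [h₁, hr, hdiv]
    by_cases hb : b = c.divNat
    · rw [if_pos hb, if_pos (congrArg _ hb)]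
      exact h₂.symm
    · rw [if_neg hb, if_neg fun h => hb (Fin.ext h)]
      exact mul_zero _
  have hker : σ'.interferenceSpace T h j ≤ LinearMap.ker φ := by
    refine iSup₂_le fun i hi => Submodule.span_le.mpr ?_
    rintro _ ⟨c, rfl⟩
    refine funext fun b => (congrArg π (hρ i c b)).trans ?_
    split_ifs
    · refine (Submodule.starProjection_apply_eq_zero_iff _).mpr ?_
      rw [Submodule.orthogonal_orthogonal]
      exact Submodule.mem_iSup_of_mem i (Submodule.mem_iSup_of_mem hi
        (Submodule.subset_span ⟨c.modNat, rfl⟩))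
    · exact map_zero π
  have hsingle : ∀ b, ∀ z ∈ (σ.receivedSpace h j j).map π,
      Pi.single b z ∈ (σ'.receivedSpace h j j).map φ := by
    intro b
    change (σ.receivedSpace h j j).map π ≤ ((σ'.receivedSpace h j j).map φ).comap
      (LinearMap.single ℂ (fun _ : Fin q => EuclideanSpace ℂ (Fin m₀)) b)
    refine Submodule.map_le_iff_le_comap.mpr (Submodule.span_le.mpr ?_)
    rintro _ ⟨c, rfl⟩
    refine ⟨col' j (finProdFinEquiv (b, c)), Submodule.subset_span ⟨_, rfl⟩, ?_⟩
    have hbc := finProdFinEquiv.symm_apply_apply (b, c)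
    rw [finProdFinEquiv_symm_apply, Prod.mk.injEq] at hbc
    funext b'
    change π (ρ b' _) = (Pi.single b (π (col j c)) : Fin q → EuclideanSpace ℂ (Fin m₀)) b'
    rw [hρ, hbc.1, hbc.2]
    by_cases hb : b' = b
    · subst hb; simp
    · simp [hb]
  refine le_trans ?_ (σ'.finrank_map_le_desiredDim T h j φ hker)
  let A := (σ.receivedSpace h j j).map π
  have hA : Module.finrank ℂ (Fin q → A) = q * σ.desiredDim T h j := by
    rw [Module.finrank_pi_fintype, Finset.sum_const, Finset.card_univ, Fintype.card_fin]
    rfl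
  let Ψ : (Fin q → A) →ₗ[ℂ] (Fin q → EuclideanSpace ℂ (Fin m₀)) :=
    LinearMap.pi fun b => A.subtype ∘ₗ LinearMap.proj b
  have hΨ : ∀ y, Ψ y ∈ (σ'.receivedSpace h j j).map φ := fun y => by
    rw [← Finset.univ_sum_single (Ψ y)]
    exact Submodule.sum_mem _ fun b _ => hsingle b _ (y b).2
  rw [← hA]
  refine LinearMap.finrank_le_finrank_of_injective (f := Ψ.codRestrict _ hΨ) fun y y' hy => ?_
  funext b
  exact Subtype.ext (congrFun (congrArg Subtype.val hy) b)

theorem Secures.repeated {σ : LinearScheme K M m₀} {T : NetworkTopology K} {d : Fin K → ℕ}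
    (hσ : σ.Secures T d) (hm₀ : 0 < m₀) (hqm : q * m₀ ≤ m) :
    (σ.repeated hm₀ q m).Secures T fun j => q * d j := fun μ hμ => by
  filter_upwards [hσ μ hμ] with h hh j
  exact (Nat.mul_le_mul_left q (hh j)).trans (σ.mul_desiredDim_le_desiredDim_repeated hm₀ hqm T h j)

end LinearScheme

theorem tendsto_natDiv_mul_div (a b : ℕ) :
    Tendsto (fun m : ℕ => ((m / a * b : ℕ) : ℝ) / (m : ℝ)) atTop (𝓝 ((b : ℝ) / a)) := by
  have h1 := (tendsto_nat_floor_mul_div_atTop (R := ℝ) (a := (a : ℝ)⁻¹) (by positivity)).comp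
    (tendsto_natCast_atTop_atTop (R := ℝ))
  have h2 := h1.mul_const (b : ℝ)
  rw [inv_mul_eq_div] at h2
  refine h2.congr fun m => ?_
  have : ⌊(a : ℝ)⁻¹ * (m : ℝ)⌋₊ = m / a := by
    rw [inv_mul_eq_div, Nat.floor_div_eq_div]
  simp only [Function.comp_apply, this]
  push_cast
  ring

namespace NetworkTopology

variable {K : ℕ} (T : NetworkTopology K)

theorem minConflictDistance_le {i j : Fin K} (hj : j ∈ T.multiConflictVertices)
    (hij : T.InternalConflict i j) : T.minConflictDistance ≤ T.conflictDistance i j :=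
  iInf₂_le_of_le j hj (iInf₂_le_of_le i hij le_rfl)

theorem one_le_minConflictDistance : 1 ≤ T.minConflictDistance := by
  refine le_iInf₂ fun j _ => le_iInf₂ fun i hij => ?_
  rw [Order.one_le_iff_ne_zero]
  intro h
  obtain rfl := SimpleGraph.edist_eq_zero_iff.mp h
  exact T.not_mem_self i hij.1

end NetworkTopology

theorem theorem3 {K : ℕ} (T : NetworkTopology K) (M : Fin K → ℕ) (hM : ∀ j, 2 ≤ M j)
    (hT : ∀ i, (T.coInterferers i).card ≤ 2) :
    LDoFAchievable T M (fun _ => dofValue T.minConflictDistance) ∧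
      ∀ Δ : ℕ, T.minConflictDistance = (Δ : ℕ∞) →
        ∃ σ : LinearScheme K M (2 * Δ + 3),
          (∀ i, σ.numSymbols i = Δ + 1) ∧ σ.Secures T (fun _ => Δ + 1) := by
  have hscheme : ∀ Δ : ℕ, 1 ≤ Δ → (Δ : ℕ∞) ≤ T.minConflictDistance →
      ∃ σ : LinearScheme K M (2 * Δ + 3),
        (∀ i, σ.numSymbols i = Δ + 1) ∧ σ.Secures T (fun _ => Δ + 1) := fun Δ hΔ hle =>
    T.exists_linearScheme M hM hT hΔ fun j hj i hij => hle.trans (T.minConflictDistance_le hj hij)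
  have hfin : ∀ Δ : ℕ, T.minConflictDistance = (Δ : ℕ∞) →
      ∃ σ : LinearScheme K M (2 * Δ + 3),
        (∀ i, σ.numSymbols i = Δ + 1) ∧ σ.Secures T (fun _ => Δ + 1) := fun Δ hΔ =>
    hscheme Δ (by have := T.one_le_minConflictDistance; rw [hΔ] at this; exact_mod_cast this) hΔ.ge
  refine ⟨?_, hfin⟩
  cases hmin : T.minConflictDistance with
  | coe Δ =>
    obtain ⟨σ, -, hσ⟩ := hfin Δ hmin
    refine ⟨fun m => σ.repeated (by omega) (m / (2 * Δ + 3)) m,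
      fun m _ => m / (2 * Δ + 3) * (Δ + 1),
      fun m => hσ.repeated (by omega) (Nat.div_mul_le_self _ _), fun j => ?_⟩
    have := tendsto_natDiv_mul_div (2 * Δ + 3) (Δ + 1)
    push_cast at this ⊢
    exact this
  | top =>
    -- every finite `Δ` is allowed; the largest one that fits into `m` channel uses is taken
    choose σ hσ using fun Δ : ℕ => hscheme (Δ + 1) (by omega) (by rw [hmin]; exact le_top)
    refine ⟨fun m => (σ ((m - 5) / 2)).repeated (by omega) (if 5 ≤ m then 1 else 0) m,
      fun m _ => (if 5 ≤ m then 1 else 0) * ((m - 5) / 2 + 1 + 1),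
      fun m => (hσ _).2.repeated (by omega) (by split_ifs <;> omega), fun j => ?_⟩
    have hval : dofValue ⊤ = 1 / 2 := rfl
    rw [hval]
    have hlim : Tendsto (fun m : ℕ => (1 / 2 : ℝ) - 1 / (m : ℝ)) atTop (𝓝 (1 / 2)) := by
      simpa using (tendsto_const_nhds (x := (1 / 2 : ℝ))).sub tendsto_one_div_atTop_nhds_zero_nat
    refine tendsto_of_tendsto_of_tendsto_of_le_of_le' hlim tendsto_const_nhds ?_ ?_ <;>
      filter_upwards [eventually_ge_atTop 5] with m hm <;>
      have hm0 : (0 : ℝ) < m := by exact_mod_cast (by omega : 0 < m)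
    · rw [if_pos hm, one_mul, le_div_iff₀ hm0, sub_mul, div_mul_cancel₀ _ hm0.ne']
      have : m ≤ 2 * ((m - 5) / 2 + 1 + 1) + 2 := by omega
      have : (m : ℝ) ≤ 2 * (((m - 5) / 2 + 1 + 1 : ℕ) : ℝ) + 2 := by exact_mod_cast this
      linarith
    · rw [if_pos hm, one_mul, div_le_iff₀ hm0]
      have : 2 * ((m - 5) / 2 + 1 + 1) ≤ m := by omega
      have : 2 * (((m - 5) / 2 + 1 + 1 : ℕ) : ℝ) ≤ m := by exact_mod_cast this
      linarith
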